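/- Let $k$ be an algebraically closed field. For a finite quiver $Q$ with $n$ vertices, $m$ arrows and $c$ connected components put $\beta_1(Q)=m-n+c$. For an ideal $I\subseteq kQ$, a relation $r\in I$, $r\neq 0$, is minimal if no non-zero proper subsum of $r$ lies in $I$. For a vertex $*$ let $\pi_1(Q,I,*)$ be the group of closed walks at $*$ (paths in the arrows and their formal inverses) modulo the homotopy relation generated by $\alpha^{-1}\alpha\sim s(\alpha)$, $\alpha\alpha^{-1}\sim t(\alpha)$ for the arrows $\alpha$, and $p\sim q$ whenever $p,q$ occur with non-zero coefficients in a common minimal relation of $I$. If $Q$ is connected this group is, up to isomorphism, independent of $*$ and denoted $\pi_1(Q,I)$; in general $\pi_1(Q,I)$ is the direct product of the fundamental groups of the connected components of $(Q,I)$. Write $\pi_1(Q)=\pi_1(Q,0)$. For a finite-dimensional algebra $A$ let $$\pi_1\text{-}\mathrm{rank}(A)=\max\{\dim_k \mathrm{Hom}(\pi_1(Q,I),k^+) : A\cong kQ/I,\ Q \text{ a finite quiver},\ I \text{ an admissible ideal}\}.$$ Let $A$ be a connected monomial algebra, presented by $\nu_A:kQ_A\to A$ with $Q_A$ a finite quiver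 and $I_A=\ker\nu_A$ an admissible ideal generated by paths. Let $B\subseteq A$ be a monomial subalgebra (not necessarily with the same unit) such that $Q_B$ is a subquiver of $Q_A$, presented compatibly: $\nu_B:kQ_B\to B$ is surjective, $I_B=\ker\nu_B$ is an admissible ideal generated by paths, and $\nu_B$ is the restriction of $\nu_A$ to $kQ_B$. Let $T$ be a maximal tree of $Q_A$ that extends a maximal forest of $Q_B$ (a maximal tree of each connected component of $Q_B$), and let $Q_{A|B}=Q_{A|B,T}$ be the quiver with vertices $(Q_A)_0$ and arrows $((Q_A)_1\setminus (Q_B)_1)\cup T$. Let $*$ be a vertex of $Q_A$, let $N_B\subseteq\pi_1(Q_A,I_A,*)$ be the (automatically normal) subgroup generated by the classes $[v^{-1}(u')^{-1}uv]$ with $u,u'$ parallel walks in $Q_B$ and $v$ a walk in $Q_A$ from $*$ to the source of $u$, and let $\pi_1(A|B)=\pi_1(Q_A,I_A,*)/N_B$ be the contracted fundamental group. Then: 1. $\beta_1(Q_{A|B})=\beta_1(Q_A)-\beta_1(Q_B)$. 2. The homomorphism $\pi_1(Q_B,I_B)^{\mathrm{ab}}\to\pi_1(Q_A,I_A)^{\mathrm{ab}}$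 induced by the inclusion $Q_B\subseteq Q_A$ (and by any choice of walks from $*$ to base points of the connected components of $Q_B$) is injective, and $$\pi_1(A|B)^{\mathrm{ab}}\cong \pi_1(Q_{A|B})^{\mathrm{ab}}\cong \pi_1(Q_A,I_A)^{\mathrm{ab}}/\pi_1(Q_B,I_B)^{\mathrm{ab}},$$ where the isomorphism between the first and the last group is the one induced by the identity of $\pi_1(Q_A,I_A)$. 3. The maxima defining $\pi_1\text{-}\mathrm{rank}(A)$ and $\pi_1\text{-}\mathrm{rank}(B)$ exist, $\mathrm{Hom}(\pi_1(Q_{A|B}),k^+)$ is finite-dimensional, and $$\dim_k\mathrm{Hom}(\pi_1(Q_{A|B}),k^+)=\pi_1\text{-}\mathrm{rank}(A)-\pi_1\text{-}\mathrm{rank}(B).$$ -/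

import Mathlib

open Quiver

universe t w v u

noncomputable section

namespace QuiverAlg

/-! ### The path algebra of a finite quiver -/

/-- All paths of a quiver `V`, of any length (including the trivial ones) and with any endpoints. -/
abbrev AnyPath (V : Type u) [Quiver.{v} V] : Type (max u v) := Σ a b : V, Quiver.Path a b

/-- The underlying vector space of the path algebra `kQ`: finite formal linear combinations
of paths. -/
def PathAlgebra (k : Type w) (V : Type u) [Field k] [Quiver.{v} V] : Type (max u v w) :=
  AnyPath V →₀ k

section PathAlgebra

variable {k : Type w} {V : Type u} [Field k] [Quiver.{v} V]

instance : AddCommGroup (PathAlgebra k V) := inferInstanceAs (AddCommGroup (AnyPath V →₀ k))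

instance : Module k (PathAlgebra k V) := inferInstanceAs (Module k (AnyPath V →₀ k))

/-- A linear combination of paths, seen as an element of the path algebra. -/
def PathAlgebra.ofFinsupp (r : AnyPath V →₀ k) : PathAlgebra k V := r

/-- The coefficients of an element of the path algebra. -/
def PathAlgebra.toFinsupp (r : PathAlgebra k V) : AnyPath V →₀ k := r

/-- The basis element given by a path. -/
def PathAlgebra.path (k : Type w) [Field k] (p : AnyPath V) : PathAlgebra k V :=
  PathAlgebra.ofFinsupp (Finsupp.single p 1)

open Classical in
/-- The product `p q` of two paths, composed from right to left: it is the path `q` followed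
by the path `p` if `q` ends where `p` starts, and zero otherwise. -/
def PathAlgebra.mulPath (p q : AnyPath V) : PathAlgebra k V :=
  if h : q.2.1 = p.1 then
    PathAlgebra.path k ⟨q.1, p.2.1, (q.2.2.cast rfl h).comp p.2.2⟩
  else 0

/-- The bilinear extension of the product of paths. -/
def PathAlgebra.mulBilin :
    (AnyPath V →₀ k) →ₗ[k] (AnyPath V →₀ k) →ₗ[k] PathAlgebra k V :=
  Finsupp.linearCombination k fun p =>
    Finsupp.linearCombination k fun q => PathAlgebra.mulPath p q

instance : Mul (PathAlgebra k V) := ⟨fun x y => PathAlgebra.mulBilin x.toFinsupp y.toFinsupp⟩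

instance [Fintype V] : One (PathAlgebra k V) :=
  ⟨∑ a : V, PathAlgebra.path k ⟨a, a, Path.nil⟩⟩

theorem PathAlgebra.path_mul_path (p q : AnyPath V) :
    PathAlgebra.path k p * PathAlgebra.path k q = PathAlgebra.mulPath p q := by
  change PathAlgebra.mulBilin (Finsupp.single p 1) (Finsupp.single q 1) = _
  simp [PathAlgebra.mulBilin]

theorem PathAlgebra.mulPath_comp {a b c : V} (p : Quiver.Path b c) (q : Quiver.Path a b) :
    PathAlgebra.mulPath (k := k) ⟨b, c, p⟩ ⟨a, b, q⟩ =
      PathAlgebra.path k ⟨a, c, q.comp p⟩ := by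
  simp [PathAlgebra.mulPath]

theorem PathAlgebra.mulPath_of_ne {p q : AnyPath V} (h : q.2.1 ≠ p.1) :
    PathAlgebra.mulPath (k := k) p q = 0 := by
  simp [PathAlgebra.mulPath, h]

theorem PathAlgebra.add_mul' (x y z : PathAlgebra k V) : (x + y) * z = x * z + y * z := by
  change PathAlgebra.mulBilin (x.toFinsupp + y.toFinsupp) z.toFinsupp = _
  rw [map_add]; rfl

theorem PathAlgebra.mul_add' (x y z : PathAlgebra k V) : x * (y + z) = x * y + x * z := by
  change PathAlgebra.mulBilin x.toFinsupp (y.toFinsupp + z.toFinsupp) = _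
  rw [map_add]; rfl

theorem PathAlgebra.smul_mul' (c : k) (x y : PathAlgebra k V) : (c • x) * y = c • (x * y) := by
  change PathAlgebra.mulBilin (c • x.toFinsupp) y.toFinsupp = _
  rw [map_smul]; rfl

theorem PathAlgebra.mul_smul' (c : k) (x y : PathAlgebra k V) : x * (c • y) = c • (x * y) := by
  change PathAlgebra.mulBilin x.toFinsupp (c • y.toFinsupp) = _
  rw [map_smul]; rfl

theorem PathAlgebra.zero_mul' (x : PathAlgebra k V) : 0 * x = 0 := by
  simpa using PathAlgebra.smul_mul' (0 : k) 0 x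

theorem PathAlgebra.mul_zero' (x : PathAlgebra k V) : x * 0 = 0 := by
  simpa using PathAlgebra.mul_smul' (0 : k) x 0

/-- Linear statements about the path algebra can be checked on paths. -/
theorem PathAlgebra.induction {P : PathAlgebra k V → Prop} (x : PathAlgebra k V)
    (zero : P 0) (add : ∀ x y, P x → P y → P (x + y))
    (smul : ∀ (c : k) (p : AnyPath V), P (c • PathAlgebra.path k p)) : P x := by
  refine Finsupp.induction_linear (motive := P) x zero (fun f g hf hg => add f g hf hg)
    fun p c => ?_
  have h := smul c p
  have e : c • PathAlgebra.path k p = PathAlgebra.ofFinsupp (Finsupp.single p c) := by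
    change c • Finsupp.single p (1 : k) = Finsupp.single p c
    simp
  rw [e] at h
  exact h

theorem PathAlgebra.path_assoc (p q r : AnyPath V) :
    PathAlgebra.path k p * PathAlgebra.path k q * PathAlgebra.path k r =
      PathAlgebra.path k p * (PathAlgebra.path k q * PathAlgebra.path k r) := by
  obtain ⟨c, d, p⟩ := p
  obtain ⟨b, c', q⟩ := q
  obtain ⟨a, b', r⟩ := r
  by_cases h : c' = c
  · subst h
    by_cases h' : b' = b
    · subst h'
      simp only [PathAlgebra.path_mul_path, PathAlgebra.mulPath_comp, Path.comp_assoc]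
    · rw [PathAlgebra.path_mul_path, PathAlgebra.path_mul_path, PathAlgebra.mulPath_comp,
        PathAlgebra.path_mul_path, PathAlgebra.mulPath_of_ne h', PathAlgebra.mulPath_of_ne h',
        PathAlgebra.mul_zero']
  · rw [PathAlgebra.path_mul_path, PathAlgebra.path_mul_path, PathAlgebra.mulPath_of_ne h,
      PathAlgebra.zero_mul']
    by_cases h' : b' = b
    · subst h'
      rw [PathAlgebra.mulPath_comp, PathAlgebra.path_mul_path, PathAlgebra.mulPath_of_ne h]
    · rw [PathAlgebra.mulPath_of_ne h', PathAlgebra.mul_zero']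

theorem PathAlgebra.mul_assoc' (x y z : PathAlgebra k V) : x * y * z = x * (y * z) := by
  induction x using PathAlgebra.induction with
  | zero => simp only [PathAlgebra.zero_mul']
  | add x x' hx hx' => simp only [PathAlgebra.add_mul', hx, hx']
  | smul c p =>
    induction y using PathAlgebra.induction with
    | zero => simp only [PathAlgebra.zero_mul', PathAlgebra.mul_zero']
    | add y y' hy hy' => simp only [PathAlgebra.add_mul', PathAlgebra.mul_add', hy, hy']
    | smul d q =>
      induction z using PathAlgebra.induction with
      | zero => simp only [PathAlgebra.mul_zero']
      | add z z' hz hz' => simp only [PathAlgebra.mul_add', hz, hz']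
      | smul e r =>
        simp only [PathAlgebra.smul_mul', PathAlgebra.mul_smul', PathAlgebra.path_assoc]

theorem PathAlgebra.one_mul' [Fintype V] (x : PathAlgebra k V) : 1 * x = x := by
  classical
  induction x using PathAlgebra.induction with
  | zero => exact PathAlgebra.mul_zero' _
  | add x y hx hy => rw [PathAlgebra.mul_add', hx, hy]
  | smul c p =>
    rw [PathAlgebra.mul_smul']
    congr 1
    obtain ⟨a, b, p⟩ := p
    change PathAlgebra.mulBilin (∑ a : V, Finsupp.single (⟨a, a, Path.nil⟩ : AnyPath V) (1 : k))
      (Finsupp.single ⟨a, b, p⟩ 1) = _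
    rw [map_sum, LinearMap.sum_apply, Finset.sum_eq_single b]
    · exact (PathAlgebra.path_mul_path _ _).trans (PathAlgebra.mulPath_comp _ _)
    · intro c _ hc
      exact (PathAlgebra.path_mul_path _ _).trans (PathAlgebra.mulPath_of_ne hc.symm)
    · simp

theorem PathAlgebra.mul_one' [Fintype V] (x : PathAlgebra k V) : x * 1 = x := by
  classical
  induction x using PathAlgebra.induction with
  | zero => exact PathAlgebra.zero_mul' _
  | add x y hx hy => rw [PathAlgebra.add_mul', hx, hy]
  | smul c p =>
    rw [PathAlgebra.smul_mul']
    congr 1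
    obtain ⟨a, b, p⟩ := p
    change PathAlgebra.mulBilin (Finsupp.single ⟨a, b, p⟩ 1)
      (∑ a : V, Finsupp.single (⟨a, a, Path.nil⟩ : AnyPath V) (1 : k)) = _
    rw [map_sum, Finset.sum_eq_single a]
    · refine (PathAlgebra.path_mul_path _ _).trans ((PathAlgebra.mulPath_comp _ _).trans ?_)
      rw [Path.nil_comp]
    · intro c _ hc
      exact (PathAlgebra.path_mul_path _ _).trans (PathAlgebra.mulPath_of_ne hc)
    · simp

instance [Fintype V] : Ring (PathAlgebra k V) where
  __ := (inferInstance : AddCommGroup (PathAlgebra k V))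
  mul := (· * ·)
  one := 1
  left_distrib := PathAlgebra.mul_add'
  right_distrib := PathAlgebra.add_mul'
  zero_mul := PathAlgebra.zero_mul'
  mul_zero := PathAlgebra.mul_zero'
  mul_assoc := PathAlgebra.mul_assoc'
  one_mul := PathAlgebra.one_mul'
  mul_one := PathAlgebra.mul_one'

instance [Fintype V] : Algebra k (PathAlgebra k V) :=
  Algebra.ofModule PathAlgebra.smul_mul' PathAlgebra.mul_smul'

end PathAlgebra

/-! ### Ideals and presentations -/

section Ideals

variable {k : Type w} {V : Type u} [Field k] [Quiver.{v} V] [Fintype V]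

/-- An ideal `I` of `kQ` is admissible if `J ^ m ⊆ I ⊆ J ^ 2` for some `m`, where `J` is the
ideal generated by the arrows; here `J ^ m` is the span of the paths of length at least `m`. -/
def IsAdmissible (I : TwoSidedIdeal (PathAlgebra k V)) : Prop :=
  (∀ x ∈ I, ∀ p ∈ x.toFinsupp.support, 2 ≤ p.2.2.length) ∧
    ∃ m : ℕ, ∀ p : AnyPath V, m ≤ p.2.2.length → PathAlgebra.path k p ∈ I

/-- An ideal of `kQ` is monomial if it is generated by a set of paths of length at least two. -/
def IsMonomialIdeal (I : TwoSidedIdeal (PathAlgebra k V)) : Prop :=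
  ∃ Z : Set (AnyPath V), (∀ p ∈ Z, 2 ≤ p.2.2.length) ∧
    I = TwoSidedIdeal.span (PathAlgebra.path k '' Z)

/-- `ν` presents `A` as `kQ / I` with `I` an admissible ideal. -/
def IsAdmissiblePresentation {A : Type*} [Ring A] [Algebra k A]
    (ν : PathAlgebra k V →ₐ[k] A) : Prop :=
  Function.Surjective ν ∧ IsAdmissible (TwoSidedIdeal.ker ν)

/-- `ν` presents `A` as a monomial algebra `kQ / I`, with `I` an admissible ideal generated by
paths. -/
def IsMonomialPresentation {A : Type*} [Ring A] [Algebra k A]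
    (ν : PathAlgebra k V →ₐ[k] A) : Prop :=
  IsAdmissiblePresentation ν ∧ IsMonomialIdeal (TwoSidedIdeal.ker ν)

open Classical in
/-- A minimal relation: a non-zero element of `I` such that no non-zero proper subsum of it
lies in `I`. -/
def IsMinimalRelation (I : TwoSidedIdeal (PathAlgebra k V)) (r : PathAlgebra k V) : Prop :=
  r ∈ I ∧ r ≠ 0 ∧ ∀ S : Set (AnyPath V),
    PathAlgebra.ofFinsupp (r.toFinsupp.filter (· ∈ S)) ∈ I →
      r.toFinsupp.filter (· ∈ S) = 0 ∨ r.toFinsupp.filter (· ∈ S) = r.toFinsupp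

end Ideals

/-- An algebra is connected if it is non-zero and not a product of two non-zero algebras, that
is, its only central idempotents are `0` and `1`. -/
def IsConnectedAlgebra (A : Type*) [Ring A] : Prop :=
  Nontrivial A ∧ ∀ e : A, IsIdempotentElem e → (∀ a : A, e * a = a * e) → e = 0 ∨ e = 1

/-! ### Walks, homotopy, and the fundamental group of a bound quiver -/

/-- A walk: a path in the quiver to which a formal inverse of each arrow has been added. -/
def Walk {V : Type u} [Quiver.{v} V] (a b : V) : Type (max u v) :=
  @Quiver.Path (Symmetrify V) _ a b

section Walk

variable {V : Type u} [Quiver.{v} V]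

/-- The trivial walk. -/
def Walk.nil (a : V) : Walk a a := @Quiver.Path.nil (Symmetrify V) _ a

/-- The walk `u` followed by the walk `w`. -/
def Walk.comp {a b c : V} (u : Walk a b) (w : Walk b c) : Walk a c :=
  @Quiver.Path.comp (Symmetrify V) _ a b c u w

/-- The formal inverse of a walk. -/
def Walk.inv {a b : V} (u : Walk a b) : Walk b a :=
  @Quiver.Path.reverse (Symmetrify V) _ _ a b u

/-- An arrow, seen as a walk. -/
def Walk.arrow {a b : V} (α : a ⟶ b) : Walk a b :=
  @Quiver.Path.cons (Symmetrify V) _ a a b Quiver.Path.nil (Sum.inl α)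

/-- The formal inverse of an arrow, seen as a walk. -/
def Walk.invArrow {a b : V} (α : a ⟶ b) : Walk b a :=
  @Quiver.Path.cons (Symmetrify V) _ b b a Quiver.Path.nil (Sum.inr α)

/-- A path, seen as a walk. -/
def Walk.ofPath {a b : V} (p : Quiver.Path a b) : Walk a b := Symmetrify.of.mapPath p

theorem Walk.nil_comp {a b : V} (u : Walk a b) : (Walk.nil a).comp u = u :=
  @Quiver.Path.nil_comp (Symmetrify V) _ a b u

theorem Walk.comp_nil {a b : V} (u : Walk a b) : u.comp (Walk.nil b) = u := rfl

theorem Walk.comp_assoc {a b c d : V} (u : Walk a b) (w : Walk b c) (z : Walk c d) :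
    (u.comp w).comp z = u.comp (w.comp z) :=
  @Quiver.Path.comp_assoc (Symmetrify V) _ a b c d u w z

theorem Walk.inv_inv {a b : V} (u : Walk a b) : u.inv.inv = u :=
  @Quiver.Path.reverse_reverse (Symmetrify V) _ _ a b u

theorem Walk.inv_comp {a b c : V} (u : Walk a b) (w : Walk b c) :
    (u.comp w).inv = w.inv.comp u.inv :=
  @Quiver.Path.reverse_comp (Symmetrify V) _ _ a b c u w

theorem Walk.inv_nil (a : V) : (Walk.nil a).inv = Walk.nil a := rfl

theorem Walk.inv_arrow {a b : V} (α : a ⟶ b) : (Walk.arrow α).inv = Walk.invArrow α := rfl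

theorem Walk.inv_invArrow {a b : V} (α : a ⟶ b) : (Walk.invArrow α).inv = Walk.arrow α := rfl

/-- Walks are built from the trivial ones by appending arrows and inverse arrows. -/
theorem Walk.induction {a : V} {P : ∀ {b : V}, Walk a b → Prop} {b : V} (u : Walk a b)
    (nil : P (Walk.nil a))
    (arrow : ∀ {b c : V} (u : Walk a b) (α : b ⟶ c), P u → P (u.comp (Walk.arrow α)))
    (invArrow : ∀ {b c : V} (u : Walk a b) (α : c ⟶ b), P u → P (u.comp (Walk.invArrow α))) :
    P u := by
  refine @Quiver.Path.rec (Symmetrify V) _ a (fun b u => @P b u) nil ?_ b u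
  intro b c p e ih
  rcases e with α | α
  · exact arrow p α ih
  · exact invArrow p α ih

end Walk

section Pi1

variable {k : Type w} {V : Type u} [Field k] [Quiver.{v} V] [Fintype V]

/-- The homotopy relation on walks generated by `α⁻¹ α ∼ s(α)`, `α α⁻¹ ∼ t(α)` and `p ∼ q`
whenever `p` and `q` appear together in a minimal relation with non-zero coefficients. -/
inductive Homotopic (I : TwoSidedIdeal (PathAlgebra k V)) :
    ∀ {a b : V}, Walk a b → Walk a b → Prop
  | refl {a b : V} (u : Walk a b) : Homotopic I u u
  | symm {a b : V} {u w : Walk a b} : Homotopic I u w → Homotopic I w u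
  | trans {a b : V} {u w z : Walk a b} : Homotopic I u w → Homotopic I w z → Homotopic I u z
  | comp {a b c : V} {u u' : Walk a b} {w w' : Walk b c} :
      Homotopic I u u' → Homotopic I w w' → Homotopic I (u.comp w) (u'.comp w')
  | inv_arrow {a b : V} (α : a ⟶ b) :
      Homotopic I ((Walk.arrow α).comp (Walk.invArrow α)) (Walk.nil a)
  | arrow_inv {a b : V} (α : a ⟶ b) :
      Homotopic I ((Walk.invArrow α).comp (Walk.arrow α)) (Walk.nil b)
  | rel {a b : V} (p q : Quiver.Path a b) (r : PathAlgebra k V) : IsMinimalRelation I r →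
      r.toFinsupp ⟨a, b, p⟩ ≠ 0 → r.toFinsupp ⟨a, b, q⟩ ≠ 0 →
      Homotopic I (Walk.ofPath p) (Walk.ofPath q)

variable (I : TwoSidedIdeal (PathAlgebra k V))

theorem Homotopic.cancel_mid {a b c d : V} {u : Walk a b} {e : Walk b c} {e' : Walk c b}
    {w : Walk b d} (h : Homotopic I (e.comp e') (Walk.nil b)) :
    Homotopic I ((u.comp e).comp (e'.comp w)) (u.comp w) := by
  have h2 := Homotopic.comp (Homotopic.comp (Homotopic.refl (I := I) u) h)
    (Homotopic.refl (I := I) w)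
  simpa only [Walk.comp_nil, Walk.comp_assoc, Walk.nil_comp] using h2

theorem Homotopic.comp_inv {a b : V} (u : Walk a b) :
    Homotopic I (u.comp u.inv) (Walk.nil a) := by
  induction u using Walk.induction with
  | nil => exact Homotopic.refl _
  | arrow u α ih =>
    rw [Walk.inv_comp, Walk.inv_arrow]
    exact (Homotopic.cancel_mid I (Homotopic.inv_arrow α)).trans ih
  | invArrow u α ih =>
    rw [Walk.inv_comp, Walk.inv_invArrow]
    exact (Homotopic.cancel_mid I (Homotopic.arrow_inv α)).trans ih

theorem Homotopic.inv_comp {a b : V} (u : Walk a b) :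
    Homotopic I (u.inv.comp u) (Walk.nil b) := by
  simpa only [Walk.inv_inv] using Homotopic.comp_inv I u.inv

theorem Homotopic.inv {I : TwoSidedIdeal (PathAlgebra k V)} {a b : V} {u w : Walk a b}
    (h : Homotopic I u w) : Homotopic I u.inv w.inv := by
  have h1 : Homotopic I (u.inv.comp (w.comp w.inv)) u.inv := by
    simpa only [Walk.comp_nil] using
      Homotopic.comp (Homotopic.refl (I := I) u.inv) (Homotopic.comp_inv I w)
  have h2 : Homotopic I (u.inv.comp (w.comp w.inv)) (u.inv.comp (u.comp w.inv)) :=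
    Homotopic.comp (Homotopic.refl _) (Homotopic.comp h.symm (Homotopic.refl _))
  have h3 : Homotopic I (u.inv.comp (u.comp w.inv)) w.inv := by
    simpa only [Walk.nil_comp, Walk.comp_assoc] using
      Homotopic.comp (Homotopic.inv_comp I u) (Homotopic.refl (I := I) w.inv)
  exact h1.symm.trans (h2.trans h3)

/-- Homotopy of closed walks at `x`. -/
def homotopySetoid (x : V) : Setoid (Walk x x) where
  r := Homotopic I
  iseqv := ⟨Homotopic.refl, Homotopic.symm, Homotopic.trans⟩

/-- The fundamental group `π₁(Q, I, x)`: closed walks at `x` up to homotopy. -/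
def Pi1 (x : V) : Type (max u v) := Quotient (homotopySetoid I x)

variable {x : V}

/-- The homotopy class of a closed walk. -/
def Pi1.mk (u : Walk x x) : Pi1 I x := Quotient.mk (homotopySetoid I x) u

/-- Products are concatenations, from right to left: `[u] [w]` is the class of `w`
followed by `u`. -/
instance : Group (Pi1 I x) where
  mul := Quotient.map₂ (fun u w => w.comp u) fun _ _ h _ _ h' => Homotopic.comp h' h
  one := Pi1.mk I (Walk.nil x)
  inv := Quotient.map (fun u => u.inv) fun _ _ h => Homotopic.inv h
  mul_assoc := by
    rintro ⟨a⟩ ⟨b⟩ ⟨c⟩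
    exact congrArg (Pi1.mk I) (Walk.comp_assoc c b a).symm
  one_mul := by
    rintro ⟨a⟩
    exact congrArg (Pi1.mk I) (Walk.comp_nil a)
  mul_one := by
    rintro ⟨a⟩
    exact congrArg (Pi1.mk I) (Walk.nil_comp a)
  inv_mul_cancel := by
    rintro ⟨a⟩
    exact Quotient.sound (s := homotopySetoid I x) (Homotopic.comp_inv I a)

theorem Pi1.mk_mul (u w : Walk x x) : Pi1.mk I u * Pi1.mk I w = Pi1.mk I (w.comp u) := rfl

theorem Pi1.mk_inv (u : Walk x x) : (Pi1.mk I u)⁻¹ = Pi1.mk I u.inv := rfl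

theorem Pi1.mk_one : (1 : Pi1 I x) = Pi1.mk I (Walk.nil x) := rfl

theorem Pi1.mk_eq {u w : Walk x x} (h : Homotopic I u w) : Pi1.mk I u = Pi1.mk I w :=
  Quotient.sound (s := homotopySetoid I x) h

/-- A chosen vertex of a connected component. -/
def componentBase (c : WeaklyConnectedComponent V) : V := Quotient.out (s := zigzagSetoid V) c

/-- The fundamental group `π₁(Q, I)` of a bound quiver that need not be connected: the direct
product of the fundamental groups of its connected components. -/
abbrev Pi1Prod : Type (max u v) := ∀ c : WeaklyConnectedComponent V, Pi1 I (componentBase c)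

end Pi1

/-- The vector space `Hom(G, k⁺)` of group homomorphisms to the additive group of `k`. -/
abbrev DualGroup (k : Type*) [Field k] (G : Type*) [Group G] : Type _ := Additive G →+ k

/-- The first Betti number `m - n + c` of a finite quiver with `n` vertices, `m` arrows and `c`
connected components. -/
def betti (V : Type u) [Quiver.{v} V] : ℤ :=
  (Nat.card (Total V) : ℤ) - Nat.card V + Nat.card (WeaklyConnectedComponent V)

/-- The dimensions of `Hom(π₁(Q, I), k⁺)`, over all presentations of `A` as `kQ / I`
with `Q` a finite quiver and `I` an admissible ideal. The value does not depend on the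
universes in which the finite quivers live. -/
def pi1Dims (k : Type w) [Field k] (A : Type t) [Ring A] [Algebra k A] : Set ℕ :=
  {d | ∃ (V : Type u) (_ : Fintype V) (_ : Quiver.{v} V) (_ : ∀ a b : V, Finite (a ⟶ b))
    (ν : PathAlgebra k V →ₐ[k] A), IsAdmissiblePresentation ν ∧
      Module.rank k (DualGroup k (Pi1Prod (TwoSidedIdeal.ker ν))) = d}

/-- The `π₁`-rank of `A`, the maximum of the dimensions in `pi1Dims k A`. -/
def pi1Rank (k : Type w) [Field k] (A : Type t) [Ring A] [Algebra k A] : ℕ :=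
  sSup (pi1Dims.{t, w, v, u} k A)

/-! ### Subquivers -/

/-- A subquiver: a set of vertices and a set of arrows between them. -/
structure Subquiver (V : Type u) [Quiver.{v} V] where
  /-- the vertices of the subquiver -/
  verts : Set V
  /-- the arrows of the subquiver -/
  arrows : WideSubquiver V
  source_mem : ∀ {a b : V} {α : a ⟶ b}, α ∈ arrows a b → a ∈ verts
  target_mem : ∀ {a b : V} {α : a ⟶ b}, α ∈ arrows a b → b ∈ verts

section Subquiver

variable {k : Type w} {V : Type u} [Field k] [Quiver.{v} V]

/-- The vertices of a subquiver, as a type. -/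
abbrev Subquiver.Vert (Q : Subquiver V) : Type u := {a : V // a ∈ Q.verts}

instance (Q : Subquiver V) : Quiver.{v} Q.Vert :=
  ⟨fun a b => {α : a.1 ⟶ b.1 // α ∈ Q.arrows a.1 b.1}⟩

instance [Fintype V] (Q : Subquiver V) : Fintype Q.Vert := Fintype.ofFinite _

instance [Fintype V] (W : WideSubquiver V) : Fintype W := inferInstanceAs (Fintype V)

/-- The inclusion of a subquiver. -/
def Subquiver.incl (Q : Subquiver V) : Q.Vert ⥤q V where
  obj := Subtype.val
  map α := α.1

/-- A path in a subquiver, seen as a path in the whole quiver. -/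
def Subquiver.mapPath (Q : Subquiver V) (p : AnyPath Q.Vert) : AnyPath V :=
  ⟨p.1.1, p.2.1.1, Q.incl.mapPath p.2.2⟩

/-- A walk in a subquiver, seen as a walk in the whole quiver. -/
def Subquiver.mapWalk (Q : Subquiver V) {a b : Q.Vert} (u : Walk a b) : Walk a.1 b.1 :=
  Q.incl.symmetrify.mapPath u

/-- The inclusion `kQ' → kQ` of path algebras for a subquiver `Q'` of `Q`. -/
def Subquiver.mapAlg (Q : Subquiver V) : PathAlgebra k Q.Vert →ₗ[k] PathAlgebra k V :=
  Finsupp.lmapDomain k k Q.mapPath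

theorem Subquiver.incl_mapPath_injective (Q : Subquiver V) {a b : Q.Vert}
    {p q : Quiver.Path a b} (h : Q.incl.mapPath p = Q.incl.mapPath q) : p = q := by
  induction p with
  | nil =>
    cases q with
    | nil => rfl
    | cons q' e =>
      have := congrArg Quiver.Path.length h
      simp at this
  | @cons b c p e ih =>
    cases q with
    | nil =>
      have := congrArg Quiver.Path.length h
      simp at this
    | @cons b' _ q' e' =>
      simp only [Prefunctor.mapPath_cons, Quiver.Path.cons.injEq] at h
      obtain ⟨h1, h2, h3⟩ := h
      have hb : b = b' := Subtype.ext h1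
      subst hb
      have hp := ih (eq_of_heq h2)
      have he : e = e' := Subtype.ext (eq_of_heq h3)
      rw [hp, he]

theorem Subquiver.mapPath_injective (Q : Subquiver V) : Function.Injective Q.mapPath := by
  rintro ⟨⟨a, ha⟩, ⟨b, hb⟩, p⟩ ⟨⟨a', ha'⟩, ⟨b', hb'⟩, q⟩ h
  have h1 : a = a' := congrArg Sigma.fst h
  subst h1
  have h2 : b = b' := congrArg (fun z : AnyPath V => z.2.1) h
  subst h2
  have h3 : Q.incl.mapPath p = Q.incl.mapPath q :=
    eq_of_heq (Sigma.mk.inj (eq_of_heq (Sigma.mk.inj h).2)).2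
  have h4 : p = q := Q.incl_mapPath_injective h3
  subst h4
  rfl

theorem Subquiver.mapWalk_comp (Q : Subquiver V) {a b c : Q.Vert} (u : Walk a b)
    (w : Walk b c) : Q.mapWalk (u.comp w) = (Q.mapWalk u).comp (Q.mapWalk w) :=
  Q.incl.symmetrify.mapPath_comp u w

theorem Subquiver.mapWalk_ofPath (Q : Subquiver V) {a b : Q.Vert} (p : Quiver.Path a b) :
    Q.mapWalk (Walk.ofPath p) = Walk.ofPath (Q.incl.mapPath p) := by
  induction p with
  | nil => rfl
  | cons p e ih =>
    exact congrArg (fun z => Walk.comp z (Walk.arrow (Q.incl.map e))) ih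

open Classical in
theorem Subquiver.filter_mapAlg (Q : Subquiver V) (r : AnyPath Q.Vert →₀ k)
    (S : Set (AnyPath V)) :
    (Finsupp.mapDomain Q.mapPath r).filter (· ∈ S) =
      Finsupp.mapDomain Q.mapPath (r.filter (· ∈ Q.mapPath ⁻¹' S)) := by
  induction r using Finsupp.induction_linear with
  | zero => rw [Finsupp.filter_zero, Finsupp.mapDomain_zero, Finsupp.filter_zero]
  | add f g hf hg => simp only [Finsupp.mapDomain_add, Finsupp.filter_add, hf, hg]
  | single p c =>
    by_cases h : Q.mapPath p ∈ S
    · rw [Finsupp.mapDomain_single, Finsupp.filter_single_of_pos _ h,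
        Finsupp.filter_single_of_pos _ (show p ∈ Q.mapPath ⁻¹' S from h),
        Finsupp.mapDomain_single]
    · rw [Finsupp.mapDomain_single, Finsupp.filter_single_of_neg _ h,
        Finsupp.filter_single_of_neg _ (show p ∉ Q.mapPath ⁻¹' S from h),
        Finsupp.mapDomain_zero]

variable [Fintype V]

/-- Compatibility of ideals along a subquiver: `I'` is the intersection of `I` with `kQ'`. -/
def Subquiver.Compatible (Q : Subquiver V) (I' : TwoSidedIdeal (PathAlgebra k Q.Vert))
    (I : TwoSidedIdeal (PathAlgebra k V)) : Prop :=
  ∀ x, x ∈ I' ↔ Q.mapAlg x ∈ I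

/-- The kernels of a relative presentation are compatible. -/
theorem Subquiver.compatible_ker {A B : Type*} [Ring A] [Algebra k A] [Ring B] [Algebra k B]
    {Q : Subquiver V} {ι : B →ₙₐ[k] A} (hι : Function.Injective ι)
    {νA : PathAlgebra k V →ₐ[k] A} {νB : PathAlgebra k Q.Vert →ₐ[k] B}
    (h : ∀ x, ι (νB x) = νA (Q.mapAlg x)) :
    Q.Compatible (TwoSidedIdeal.ker νB) (TwoSidedIdeal.ker νA) := by
  intro x
  rw [TwoSidedIdeal.mem_ker, TwoSidedIdeal.mem_ker, ← h, map_eq_zero_iff ι hι]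

theorem IsMinimalRelation.map {Q : Subquiver V} {I' : TwoSidedIdeal (PathAlgebra k Q.Vert)}
    {I : TwoSidedIdeal (PathAlgebra k V)} (hI : Q.Compatible I' I) {r : PathAlgebra k Q.Vert}
    (hr : IsMinimalRelation I' r) : IsMinimalRelation I (Q.mapAlg r) := by
  classical
  obtain ⟨h1, h2, h3⟩ := hr
  have hinj := Finsupp.mapDomain_injective (M := k) Q.mapPath_injective
  refine ⟨(hI r).1 h1, fun h0 => h2 (hinj (h0.trans Finsupp.mapDomain_zero.symm)), fun S hS => ?_⟩
  have e : (Q.mapAlg r).toFinsupp.filter (· ∈ S) =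
      Finsupp.mapDomain Q.mapPath (r.toFinsupp.filter (· ∈ Q.mapPath ⁻¹' S)) := by
    rw [← Q.filter_mapAlg]
    rfl
  rw [e] at hS ⊢
  rcases h3 (Q.mapPath ⁻¹' S) ((hI _).2 hS) with h | h
  · left
    rw [h, Finsupp.mapDomain_zero]
  · right
    rw [h]
    rfl

theorem Homotopic.mapWalk {Q : Subquiver V} {I' : TwoSidedIdeal (PathAlgebra k Q.Vert)}
    {I : TwoSidedIdeal (PathAlgebra k V)} (hI : Q.Compatible I' I) {a b : Q.Vert}
    {u w : Walk a b} (h : Homotopic I' u w) : Homotopic I (Q.mapWalk u) (Q.mapWalk w) := by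
  induction h with
  | refl u => exact Homotopic.refl _
  | symm _ ih => exact ih.symm
  | trans _ _ ih ih' => exact ih.trans ih'
  | comp _ _ ih ih' =>
    rw [Q.mapWalk_comp, Q.mapWalk_comp]
    exact ih.comp ih'
  | inv_arrow α => exact Homotopic.inv_arrow α.1
  | arrow_inv α => exact Homotopic.arrow_inv α.1
  | rel p q r hr hp hq =>
    rw [Q.mapWalk_ofPath, Q.mapWalk_ofPath]
    have key : ∀ s, (Q.mapAlg r).toFinsupp (Q.mapPath s) = r.toFinsupp s := fun s =>
      Finsupp.mapDomain_apply Q.mapPath_injective r.toFinsupp s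
    exact Homotopic.rel _ _ (Q.mapAlg r) (hr.map hI) ((key ⟨_, _, p⟩).trans_ne hp)
      ((key ⟨_, _, q⟩).trans_ne hq)

/-- Given a walk `γ` from `x₀` to a vertex `y` of a subquiver `Q'` of `Q`, the homomorphism
`π₁(Q', I', y) → π₁(Q, I, x₀)`, `[u] ↦ [γ⁻¹ u γ]`. -/
def Subquiver.pi1Map {Q : Subquiver V} {I' : TwoSidedIdeal (PathAlgebra k Q.Vert)}
    {I : TwoSidedIdeal (PathAlgebra k V)} (hI : Q.Compatible I' I) {x₀ : V} {y : Q.Vert}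
    (γ : Walk x₀ y.1) : Pi1 I' y →* Pi1 I x₀ where
  toFun := Quotient.map (fun u => (γ.comp (Q.mapWalk u)).comp γ.inv) fun _ _ h =>
    ((Homotopic.refl γ).comp (h.mapWalk hI)).comp (Homotopic.refl γ.inv)
  map_one' := Pi1.mk_eq I (Homotopic.comp_inv I γ)
  map_mul' := by
    rintro ⟨u⟩ ⟨w⟩
    refine Pi1.mk_eq I ?_
    have h : Homotopic I (((γ.comp (Q.mapWalk w)).comp γ.inv).comp
        (γ.comp ((Q.mapWalk u).comp γ.inv)))
        ((γ.comp (Q.mapWalk w)).comp ((Q.mapWalk u).comp γ.inv)) :=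
      Homotopic.cancel_mid I (Homotopic.inv_comp I γ)
    have e1 : (γ.comp (Q.mapWalk (w.comp u))).comp γ.inv =
        (γ.comp (Q.mapWalk w)).comp ((Q.mapWalk u).comp γ.inv) := by
      rw [Q.mapWalk_comp]
      simp only [Walk.comp_assoc]
    have e2 : ((γ.comp (Q.mapWalk w)).comp γ.inv).comp ((γ.comp (Q.mapWalk u)).comp γ.inv) =
        ((γ.comp (Q.mapWalk w)).comp γ.inv).comp (γ.comp ((Q.mapWalk u).comp γ.inv)) := by
      simp only [Walk.comp_assoc]
    change Homotopic I ((γ.comp (Q.mapWalk (w.comp u))).comp γ.inv)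
      (((γ.comp (Q.mapWalk w)).comp γ.inv).comp ((γ.comp (Q.mapWalk u)).comp γ.inv))
    rw [e1, e2]
    exact h.symm

open Classical in
/-- The homomorphism `π₁(Q', I')ᵃᵇ → π₁(Q, I, x₀)ᵃᵇ` induced by the inclusion of a subquiver `Q'`
of `Q`, where `γ` chooses a walk from the base point `x₀` to the base point of each connected
component of `Q'` (the result does not depend on `γ`). -/
def Subquiver.abMap {Q : Subquiver V} {I' : TwoSidedIdeal (PathAlgebra k Q.Vert)}
    {I : TwoSidedIdeal (PathAlgebra k V)} (hI : Q.Compatible I' I) {x₀ : V}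
    (γ : ∀ c : WeaklyConnectedComponent Q.Vert, Walk x₀ (componentBase c).1) :
    Abelianization (Pi1Prod I') →* Abelianization (Pi1 I x₀) :=
  haveI : Finite (WeaklyConnectedComponent Q.Vert) :=
    inferInstanceAs (Finite (Quotient (zigzagSetoid Q.Vert)))
  letI := Fintype.ofFinite (WeaklyConnectedComponent Q.Vert)
  Abelianization.lift (∏ c : WeaklyConnectedComponent Q.Vert,
    (Abelianization.of.comp (Subquiver.pi1Map hI (γ c))).comp
      (Pi.evalMonoidHom (fun c => Pi1 I' (componentBase c)) c))

/-! ### The contracted fundamental group -/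

/-- The classes `[v⁻¹ u'⁻¹ u v]`, with `u`, `u'` parallel walks in the subquiver and `v` a walk
starting at the base point. -/
def Subquiver.contractionGenerators (Q : Subquiver V) (I : TwoSidedIdeal (PathAlgebra k V))
    (x₀ : V) : Set (Pi1 I x₀) :=
  {g | ∃ (a b : Q.Vert) (u u' : Walk a b) (z : Walk x₀ a.1),
    g = Pi1.mk I (((z.comp (Q.mapWalk u)).comp (Q.mapWalk u').inv).comp z.inv)}

/-- The subgroup `N` of `π₁(Q, I, x₀)` generated by the classes `[v⁻¹ u'⁻¹ u v]`. -/
def Subquiver.contractionSubgroup (Q : Subquiver V) (I : TwoSidedIdeal (PathAlgebra k V))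
    (x₀ : V) : Subgroup (Pi1 I x₀) :=
  Subgroup.closure (Q.contractionGenerators I x₀)

instance (Q : Subquiver V) (I : TwoSidedIdeal (PathAlgebra k V)) (x₀ : V) :
    (Q.contractionSubgroup I x₀).Normal where
  conj_mem := by
    intro n hn g
    induction hn using Subgroup.closure_induction with
    | mem n hn =>
      obtain ⟨a, b, u, u', z, rfl⟩ := hn
      induction g using Quotient.inductionOn with
      | _ g =>
      refine Subgroup.subset_closure ⟨a, b, u, u', g.inv.comp z, ?_⟩
      change Pi1.mk I (g.inv.comp _) = _
      refine congrArg (Pi1.mk I) ?_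
      simp only [Walk.inv_comp, Walk.inv_inv, Walk.comp_assoc]
    | one => simp
    | mul x y _ _ hx hy =>
      have := mul_mem hx hy
      simpa [mul_assoc] using this
    | inv x _ hx =>
      have := inv_mem hx
      simpa [mul_assoc] using this

/-- The contracted fundamental group `π₁(Q, I, x₀) / N` relative to a subquiver. -/
abbrev Subquiver.ContractedPi1 (Q : Subquiver V) (I : TwoSidedIdeal (PathAlgebra k V))
    (x₀ : V) : Type (max u v) :=
  Pi1 I x₀ ⧸ Q.contractionSubgroup I x₀

/-! ### Trees and the quiver `Q_{A|B,T}` -/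

/-- A vertex, seen as a vertex of a wide subquiver. -/
def toWide (W : WideSubquiver V) (a : V) : W := a

/-- Two vertices are joined by a walk that uses only the arrows in `W`. -/
def Joined (W : WideSubquiver V) (a b : V) : Prop := Nonempty (Walk (toWide W a) (toWide W b))

/-- The set `W` of arrows without the arrow `α`. -/
def deleteArrow (W : WideSubquiver V) (α : Total V) : WideSubquiver V :=
  fun a b => {β | β ∈ W a b ∧ Total.mk a b β ≠ α}

/-- A set of arrows is a forest (its underlying graph has no cycles): no arrow of it joins two
vertices that are already joined by a walk through the other arrows. -/
def IsForest (W : WideSubquiver V) : Prop :=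
  ∀ (a b : V) (α : a ⟶ b), α ∈ W a b → ¬ Joined (deleteArrow W ⟨a, b, α⟩) a b

/-- `F` is a maximal forest of `W`: a forest in `W` that restricts to a maximal (spanning)
tree of each connected component of `W`. -/
def IsMaximalForest (F W : WideSubquiver V) : Prop :=
  (∀ a b, F a b ⊆ W a b) ∧ IsForest F ∧ ∀ a b, Joined W a b → Joined F a b

/-- The arrows of `T` that lie in the subquiver. -/
def Subquiver.treePart (Q : Subquiver V) (T : WideSubquiver V) : WideSubquiver V :=
  fun a b => T a b ∩ Q.arrows a b

/-- `T` is an extended maximal tree: a maximal tree of the whole quiver (which is connected)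
extending a maximal forest of the subquiver. -/
def Subquiver.IsExtendedMaximalTree (Q : Subquiver V) (T : WideSubquiver V) : Prop :=
  IsForest T ∧ (∀ a b, Joined T a b) ∧
    IsMaximalForest (Q.treePart T) Q.arrows

/-- The quiver `Q_{A|B,T}`: all vertices, and the arrows that are not in the subquiver
or are in `T`. -/
def Subquiver.relQuiver (Q : Subquiver V) (T : WideSubquiver V) : WideSubquiver V :=
  fun a b => (Q.arrows a b)ᶜ ∪ T a b

/-- The fundamental group of the quiver `Q_{A|B,T}` (with no relations). -/
abbrev Subquiver.RelPi1 (k : Type w) [Field k] (Q : Subquiver V) (T : WideSubquiver V) (x₀ : V) :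
    Type (max u v) :=
  Pi1 (⊥ : TwoSidedIdeal (PathAlgebra k (Q.relQuiver T))) (toWide (Q.relQuiver T) x₀)

end Subquiver

end QuiverAlg

end

open QuiverAlg

/-!
A minimal relation of a monomial ideal is a scalar multiple of one path, so homotopy merely cancels
arrows against their inverses. Counting the arrows of a closed walk with signs therefore identifies
the abelianized fundamental group with the group of 1-cycles of the underlying graph, a free group
of rank `β₁`. Replacing every arrow of `Q_B` by the path through the maximal forest that joins its
ends splits the cycles of `Q_A` as the direct sum of those of `Q_B` and those of `Q_{A|B}`; this
gives the first two parts.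

For any admissible ideal the abelianized fundamental group is a quotient of the one of the bare
quiver, hence contributes at most `β₁` to the `π₁`-rank, and a monomial presentation attains the
bound. Different presentations of `A` have the same `β₁`: with `r` the radical, the numbers of
arrows, vertices and components can be read off `r / r²`, `A / r` and the image of the center in
`A / r`.
-/

noncomputable section

namespace QuiverAlg

/-! ### Chains, boundaries and cycles -/

section Cycles

variable {V : Type*} [Quiver V]

/-- The 1-chain of a walk, in which every arrow is counted with the sign of its direction. -/
def Walk.chain {a b : V} (u : Walk a b) : Total V →₀ ℤ :=
  Path.addWeight (V := Symmetrify V)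
    (Sum.elim (fun α => .single (.mk _ _ α) 1) fun α => -.single (.mk _ _ α) 1) u

theorem Walk.chain_nil (a : V) : (nil a).chain = 0 :=
  Path.addWeight_nil (V := Symmetrify V) _ a

theorem Walk.chain_comp {a b c : V} (u : Walk a b) (w : Walk b c) :
    (u.comp w).chain = u.chain + w.chain :=
  Path.addWeight_comp (V := Symmetrify V) _ u w

theorem Walk.chain_arrow {a b : V} (α : a ⟶ b) : (arrow α).chain = .single (.mk a b α) 1 :=
  (Path.addWeight_cons (V := Symmetrify V) _ .nil _).trans
    (add_eq_right.2 (Path.addWeight_nil (V := Symmetrify V) _ _))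

theorem Walk.chain_invArrow {a b : V} (α : a ⟶ b) :
    (invArrow α).chain = -.single (.mk a b α) 1 :=
  (Path.addWeight_cons (V := Symmetrify V) _ .nil _).trans
    (add_eq_right.2 (Path.addWeight_nil (V := Symmetrify V) _ _))

theorem Walk.chain_inv {a b : V} (u : Walk a b) : u.inv.chain = -u.chain := by
  induction u using Walk.induction with
  | nil => rw [inv_nil, chain_nil, neg_zero]
  | arrow u α ih =>
    rw [inv_comp, chain_comp, inv_arrow, chain_comp, ih, chain_arrow, chain_invArrow, neg_add_rev]
  | invArrow u α ih =>
    rw [inv_comp, chain_comp, inv_invArrow, chain_comp, ih, chain_arrow, chain_invArrow,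
      neg_add_rev, neg_neg]

variable (V) in
/-- The boundary of 1-chains, sending an arrow to the difference of its target and its source. -/
def boundary : (Total V →₀ ℤ) →ₗ[ℤ] (V →₀ ℤ) :=
  Finsupp.linearCombination ℤ fun α => .single α.right 1 - .single α.left 1

theorem boundary_single (α : Total V) (n : ℤ) :
    boundary V (.single α n) = .single α.right n - .single α.left n := by
  simp [boundary, smul_sub]

theorem Walk.boundary_chain {a b : V} (u : Walk a b) :
    boundary V u.chain = .single b 1 - .single a 1 := by
  induction u using Walk.induction with
  | nil => rw [chain_nil, map_zero, sub_self]
  | arrow u α ih =>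
    rw [chain_comp, map_add, ih, chain_arrow, boundary_single, sub_add_sub_cancel']
  | invArrow u α ih =>
    rw [chain_comp, map_add, ih, chain_invArrow, map_neg, boundary_single, neg_sub,
      sub_add_sub_cancel']

variable (V) in
/-- The group of 1-cycles of a quiver, that is, the first homology group of its underlying
graph. -/
def cycles : Submodule ℤ (Total V →₀ ℤ) := LinearMap.ker (boundary V)

theorem mem_cycles {z : Total V →₀ ℤ} : z ∈ cycles V ↔ boundary V z = 0 := Iff.rfl

theorem Walk.chain_mem_cycles {a : V} (u : Walk a a) : u.chain ∈ cycles V := by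
  rw [mem_cycles, boundary_chain, sub_self]

/-- The cycles supported on a set of arrows. -/
def cyclesOn (S : Set (Total V)) : Submodule ℤ (cycles V) :=
  (Finsupp.supported ℤ ℤ S).comap (cycles V).subtype

theorem mem_cyclesOn {S : Set (Total V)} {z : cycles V} :
    z ∈ cyclesOn S ↔ z.1 ∈ Finsupp.supported ℤ ℤ S := Iff.rfl

theorem cyclesOn_mono {S S' : Set (Total V)} (h : S ⊆ S') : cyclesOn S ≤ cyclesOn S' :=
  Submodule.comap_mono (Finsupp.supported_mono h)

theorem cyclesOn_inf (S S' : Set (Total V)) :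
    cyclesOn S ⊓ cyclesOn S' = cyclesOn (S ∩ S') := by
  rw [cyclesOn, cyclesOn, cyclesOn, Finsupp.supported_inter, Submodule.comap_inf]

end Cycles

section CyclesMap

variable {U V : Type*} [Quiver U] [Quiver V]

/-- The map on arrows induced by a morphism of quivers. -/
def mapTotal (Φ : U ⥤q V) (α : Total U) : Total V := .mk _ _ (Φ.map α.hom)

theorem mapTotal_injective {Φ : U ⥤q V} (hobj : Function.Injective Φ.obj)
    (hmap : ∀ a b : U, Function.Injective (Φ.map : (a ⟶ b) → _)) :
    Function.Injective (mapTotal Φ) := by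
  rintro ⟨a, b, α⟩ ⟨a', b', α'⟩ h
  obtain rfl : a = a' := hobj (congrArg Total.left h)
  obtain rfl : b = b' := hobj (congrArg Total.right h)
  obtain ⟨-, -, h⟩ := Total.mk.inj h
  exact congrArg (Total.mk a b) (hmap a b (eq_of_heq h))

/-- The image of a walk under a morphism of quivers. -/
def Walk.map (Φ : U ⥤q V) {a b : U} (u : Walk a b) : Walk (Φ.obj a) (Φ.obj b) :=
  Φ.symmetrify.mapPath u

theorem Walk.map_comp (Φ : U ⥤q V) {a b c : U} (u : Walk a b) (w : Walk b c) :
    (u.comp w).map Φ = (u.map Φ).comp (w.map Φ) :=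
  Φ.symmetrify.mapPath_comp u w

theorem Walk.chain_map (Φ : U ⥤q V) {a b : U} (u : Walk a b) :
    (u.map Φ).chain = u.chain.mapDomain (mapTotal Φ) := by
  induction u using Walk.induction with
  | nil => exact chain_nil _ |>.trans (by rw [chain_nil, Finsupp.mapDomain_zero])
  | arrow u α ih =>
    rw [map_comp, chain_comp, chain_comp, ih, Finsupp.mapDomain_add, chain_arrow,
      Finsupp.mapDomain_single]
    exact congrArg _ (chain_arrow (Φ.map α))
  | invArrow u α ih =>
    rw [map_comp, chain_comp, chain_comp, ih, Finsupp.mapDomain_add, chain_invArrow,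
      ← Finsupp.single_neg, Finsupp.mapDomain_single, Finsupp.single_neg]
    exact congrArg _ (chain_invArrow (Φ.map α))

theorem boundary_mapDomain (Φ : U ⥤q V) (z : Total U →₀ ℤ) :
    boundary V (z.mapDomain (mapTotal Φ)) = (boundary U z).mapDomain Φ.obj := by
  induction z using Finsupp.induction_linear with
  | zero => simp only [Finsupp.mapDomain_zero, map_zero]
  | add x y hx hy => rw [Finsupp.mapDomain_add, map_add, map_add, Finsupp.mapDomain_add, hx, hy]
  | single α n =>
    rw [Finsupp.mapDomain_single, boundary_single, boundary_single, sub_eq_add_neg,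
      ← Finsupp.single_neg, sub_eq_add_neg, ← Finsupp.single_neg, Finsupp.mapDomain_add,
      Finsupp.mapDomain_single, Finsupp.mapDomain_single]
    rfl

/-- The map on cycles induced by a morphism of quivers. -/
def cyclesMap (Φ : U ⥤q V) : cycles U →ₗ[ℤ] cycles V :=
  (Finsupp.lmapDomain ℤ ℤ (mapTotal Φ)).restrict fun z hz => by
    rw [mem_cycles, Finsupp.lmapDomain_apply, boundary_mapDomain, mem_cycles.1 hz,
      Finsupp.mapDomain_zero]

theorem cyclesMap_injective {Φ : U ⥤q V} (hΦ : Function.Injective (mapTotal Φ)) :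
    Function.Injective (cyclesMap Φ) := fun _ _ h =>
  Subtype.ext (Finsupp.mapDomain_injective hΦ (congrArg Subtype.val h))

theorem range_cyclesMap {Φ : U ⥤q V} (hΦ : Function.Injective Φ.obj) :
    LinearMap.range (cyclesMap Φ) = cyclesOn (Set.range (mapTotal Φ)) := by
  have hrange : LinearMap.range (Finsupp.lmapDomain ℤ ℤ (mapTotal Φ)) =
      Finsupp.supported ℤ ℤ (Set.range (mapTotal Φ)) := by
    rw [← Set.image_univ, ← Finsupp.lmapDomain_supported, Finsupp.supported_univ,
      Submodule.map_top]
  ext ⟨z, hz⟩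
  rw [mem_cyclesOn, ← hrange]
  refine ⟨fun ⟨y, hy⟩ => ⟨y.1, congrArg Subtype.val hy⟩, fun ⟨y, hy⟩ => ?_⟩
  have hy' : y ∈ cycles U := by
    refine mem_cycles.2 (Finsupp.mapDomain_injective hΦ ?_)
    rw [← boundary_mapDomain, Finsupp.mapDomain_zero]
    exact (congrArg (boundary V) hy).trans hz
  exact ⟨⟨y, hy'⟩, Subtype.ext hy⟩

end CyclesMap

/-! ### Forests -/

section Forests

variable {V : Type*} [Quiver V]

/-- The arrows of a wide subquiver, as a set. -/
def arrowSet (W : WideSubquiver V) : Set (Total V) := {α | α.hom ∈ W α.left α.right}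

/-- The inclusion of a wide subquiver. -/
def wideIncl (W : WideSubquiver V) : W ⥤q V where
  obj a := a
  map α := α.1

theorem mapTotal_wideIncl_injective (W : WideSubquiver V) :
    Function.Injective (mapTotal (wideIncl W)) :=
  mapTotal_injective (fun _ _ => id) fun _ _ => Subtype.val_injective

theorem range_mapTotal_wideIncl (W : WideSubquiver V) :
    Set.range (mapTotal (wideIncl W)) = arrowSet W := by
  ext α
  exact ⟨fun ⟨β, hβ⟩ => hβ ▸ β.hom.2,
    fun hα => ⟨.mk (toWide W α.left) (toWide W α.right) ⟨α.hom, hα⟩, rfl⟩⟩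

theorem Subquiver.mapTotal_incl_injective (Q : Subquiver V) :
    Function.Injective (mapTotal Q.incl) :=
  mapTotal_injective Subtype.val_injective fun _ _ => Subtype.val_injective

theorem Subquiver.range_mapTotal_incl (Q : Subquiver V) :
    Set.range (mapTotal Q.incl) = arrowSet Q.arrows := by
  ext α
  exact ⟨fun ⟨β, hβ⟩ => hβ ▸ β.hom.2, fun hα =>
    ⟨.mk (⟨α.left, Q.source_mem hα⟩ : Q.Vert) ⟨α.right, Q.target_mem hα⟩ ⟨α.hom, hα⟩, rfl⟩⟩

theorem Joined.symm {W : WideSubquiver V} {a b : V} (h : Joined W a b) : Joined W b a :=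
  h.map Walk.inv

theorem Joined.trans {W : WideSubquiver V} {a b c : V} (h : Joined W a b) (h' : Joined W b c) :
    Joined W a c :=
  h.map2 Walk.comp h'

theorem Joined.of_mem {W : WideSubquiver V} {α : Total V} (hα : α ∈ arrowSet W) :
    Joined W α.left α.right :=
  ⟨Walk.arrow (V := W) ⟨α.hom, hα⟩⟩

theorem Joined.exists_chain {W : WideSubquiver V} {a b : V} (h : Joined W a b) :
    ∃ t ∈ Finsupp.supported ℤ ℤ (arrowSet W), boundary V t = .single b 1 - .single a 1 := by
  obtain ⟨u⟩ := h
  refine ⟨(u.map (wideIncl W)).chain, ?_, Walk.boundary_chain _⟩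
  rw [Walk.chain_map, ← range_mapTotal_wideIncl, ← Set.image_univ, ← Finsupp.lmapDomain_supported]
  exact Submodule.mem_map_of_mem (Finsupp.mem_supported _ _ |>.2 (Set.subset_univ _))

theorem linearCombination_boundary (f : V → ℤ) (z : Total V →₀ ℤ) :
    Finsupp.linearCombination ℤ f (boundary V z) =
      z.sum fun α n => n * (f α.right - f α.left) := by
  induction z using Finsupp.induction_linear with
  | zero => simp only [map_zero, Finsupp.sum_zero_index]
  | add x y hx hy =>
    rw [map_add, map_add, hx, hy, Finsupp.sum_add_index'] <;> intros <;> ring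
  | single α n =>
    rw [boundary_single, map_sub, Finsupp.linearCombination_single,
      Finsupp.linearCombination_single, Finsupp.sum_single_index (zero_mul _), smul_eq_mul,
      smul_eq_mul, mul_sub]

theorem IsForest.cyclesOn_eq_bot {W : WideSubquiver V} (hW : IsForest W) :
    cyclesOn (arrowSet W) = ⊥ := by
  classical
  refine (Submodule.eq_bot_iff _).2 fun ⟨z, hz⟩ hzW => Subtype.ext (Finsupp.ext fun α => ?_)
  by_contra hα
  have hαW : α ∈ arrowSet W := hzW (Finsupp.mem_support_iff.2 hα)
  -- the potential that cuts the forest at `α`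
  let f : V → ℤ := fun b => if Joined (deleteArrow W α) α.left b then 1 else 0
  have hf : ∀ β ∈ arrowSet W, β ≠ α → f β.right = f β.left := fun β hβ hne => by
    have hj : Joined (deleteArrow W α) β.left β.right := Joined.of_mem (α := β) ⟨hβ, hne⟩
    exact if_congr ⟨fun h => h.trans hj.symm, fun h => h.trans hj⟩ rfl rfl
  have hfl : f α.left = 1 := if_pos ⟨Walk.nil _⟩
  have hfr : f α.right = 0 := if_neg (hW _ _ _ hαW)
  have h := linearCombination_boundary f z
  rw [mem_cycles.1 hz, map_zero, Finsupp.sum, Finset.sum_eq_single α (fun β hβ hne => by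
    rw [hf β (hzW hβ) hne, sub_self, mul_zero]) fun h => absurd (Finsupp.notMem_support_iff.1 h) hα,
    hfl, hfr] at h
  exact hα (by simpa using h.symm)

theorem IsMaximalForest.exists_chain {F W : WideSubquiver V} (hF : IsMaximalForest F W)
    (α : Total V) :
    ∃ t ∈ Finsupp.supported ℤ ℤ ((arrowSet W)ᶜ ∪ arrowSet F),
      boundary V t = boundary V (.single α 1) ∧
        .single α 1 - t ∈ Finsupp.supported ℤ ℤ (arrowSet W) := by
  have hFW : arrowSet F ⊆ arrowSet W := fun β hβ => hF.1 _ _ hβ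
  by_cases hα : α ∈ arrowSet W
  · obtain ⟨t, htF, ht⟩ := (hF.2.2 _ _ (Joined.of_mem hα)).exists_chain
    exact ⟨t, Finsupp.supported_mono Set.subset_union_right htF,
      by rw [ht, boundary_single], sub_mem (Finsupp.single_mem_supported _ _ hα)
        (Finsupp.supported_mono hFW htF)⟩
  · exact ⟨.single α 1, Finsupp.single_mem_supported _ _ (Or.inl hα), rfl,
      by rw [sub_self]; exact zero_mem _⟩

/-- Replacing every arrow of `W` by the path through `F` that joins its ends retracts the cycles
onto those that meet `W` only in `F`. -/
theorem IsMaximalForest.isCompl_cyclesOn {F W : WideSubquiver V} (hF : IsMaximalForest F W) :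
    IsCompl (cyclesOn (arrowSet W)) (cyclesOn ((arrowSet W)ᶜ ∪ arrowSet F)) := by
  refine ⟨disjoint_iff.2 ?_, codisjoint_iff.2 (top_le_iff.1 fun ⟨z, hz⟩ _ => ?_)⟩
  · refine le_bot_iff.1 ?_
    rw [← hF.2.1.cyclesOn_eq_bot, cyclesOn_inf]
    exact cyclesOn_mono fun α hα => hα.2.resolve_left (not_not.2 hα.1)
  · choose t htsupp htbdry htdiff using hF.exists_chain
    let r : (Total V →₀ ℤ) →ₗ[ℤ] (Total V →₀ ℤ) := Finsupp.linearCombination ℤ t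
    have hr : ∀ y, r y ∈ Finsupp.supported ℤ ℤ ((arrowSet W)ᶜ ∪ arrowSet F) ∧
        boundary V (r y) = boundary V y ∧ y - r y ∈ Finsupp.supported ℤ ℤ (arrowSet W) := by
      intro y
      induction y using Finsupp.induction_linear with
      | zero => simp
      | add x y hx hy =>
        rw [map_add, map_add, map_add, hx.2.1, hy.2.1, add_sub_add_comm]
        exact ⟨add_mem hx.1 hy.1, rfl, add_mem hx.2.2 hy.2.2⟩
      | single α n =>
        have hn : (.single α n : Total V →₀ ℤ) = n • .single α 1 := by simp
        rw [Finsupp.linearCombination_single, hn, map_smul, map_smul, htbdry, ← smul_sub]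
        exact ⟨Submodule.smul_mem _ _ (htsupp α), rfl, Submodule.smul_mem _ _ (htdiff α)⟩
    have hrz : r z ∈ cycles V := (hr z).2.1.trans hz
    refine Submodule.mem_sup.2 ⟨⟨z - r z, sub_mem hz hrz⟩, (hr z).2.2, ⟨r z, hrz⟩, (hr z).1, ?_⟩
    exact Subtype.ext (sub_add_cancel z (r z))

theorem Subquiver.arrowSet_relQuiver (Q : Subquiver V) (T : WideSubquiver V) :
    arrowSet (Q.relQuiver T) = (arrowSet Q.arrows)ᶜ ∪ arrowSet (Q.treePart T) := by
  ext α
  change (¬ _ ∨ _) ↔ (¬ _ ∨ _ ∧ _)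
  tauto

theorem Subquiver.isCompl_range_cyclesMap {Q : Subquiver V} {T : WideSubquiver V}
    (hT : IsMaximalForest (Q.treePart T) Q.arrows) :
    IsCompl (LinearMap.range (cyclesMap Q.incl))
      (LinearMap.range (cyclesMap (wideIncl (Q.relQuiver T)))) := by
  rw [range_cyclesMap Subtype.val_injective, range_cyclesMap fun _ _ => id,
    Q.range_mapTotal_incl, range_mapTotal_wideIncl, Q.arrowSet_relQuiver]
  exact hT.isCompl_cyclesOn

end Forests

/-! ### The Betti number -/

section Betti

variable {V : Type*} [Quiver V]

theorem component_eq_iff {a b : V} :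
    WeaklyConnectedComponent.mk a = WeaklyConnectedComponent.mk b ↔ Nonempty (Walk a b) :=
  WeaklyConnectedComponent.eq a b

theorem mk_componentBase (c : WeaklyConnectedComponent V) :
    WeaklyConnectedComponent.mk (componentBase c) = c :=
  Quotient.out_eq (s := zigzagSetoid V) c

theorem range_boundary : LinearMap.range (boundary V) =
    LinearMap.ker (Finsupp.lmapDomain ℤ ℤ (WeaklyConnectedComponent.mk (V := V))) := by
  refine le_antisymm (LinearMap.range_le_ker_iff.2 <| Finsupp.lhom_ext fun α n => ?_) fun f hf => ?_
  · rw [LinearMap.comp_apply, boundary_single, map_sub, Finsupp.lmapDomain_apply,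
      Finsupp.lmapDomain_apply, Finsupp.mapDomain_single, Finsupp.mapDomain_single,
      component_eq_iff.2 ⟨Walk.arrow α.hom⟩, sub_self, LinearMap.zero_apply]
  · have key : ∀ f : V →₀ ℤ,
        f - (f.mapDomain WeaklyConnectedComponent.mk).mapDomain componentBase ∈
          LinearMap.range (boundary V) := fun f => by
      induction f using Finsupp.induction_linear with
      | zero => simp
      | add x y hx hy =>
        rw [Finsupp.mapDomain_add, Finsupp.mapDomain_add, add_sub_add_comm]
        exact add_mem hx hy
      | single a n =>
        obtain ⟨u⟩ := component_eq_iff.1 (mk_componentBase (WeaklyConnectedComponent.mk a))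
        refine ⟨n • u.chain, ?_⟩
        simp [u.boundary_chain, smul_sub]
    have hf' : f.mapDomain WeaklyConnectedComponent.mk = 0 := hf
    simpa only [hf', Finsupp.mapDomain_zero, sub_zero] using key f

theorem finrank_range_add_finrank_ker {R N : Type*} {M : Type u} [Ring R]
    [StrongRankCondition R] [HasRankNullity.{u} R] [AddCommGroup M] [AddCommGroup N]
    [Module R M] [Module R N] [Module.Finite R M] (f : M →ₗ[R] N) :
    Module.finrank R (LinearMap.range f) + Module.finrank R (LinearMap.ker f) =
      Module.finrank R M := by
  rw [← f.quotKerEquivRange.finrank_eq, Submodule.finrank_quotient_add_finrank]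

instance [Finite V] : Finite (WeaklyConnectedComponent V) :=
  inferInstanceAs (Finite (Quotient (zigzagSetoid V)))

instance [Finite V] [∀ a b : V, Finite (a ⟶ b)] : Finite (Total V) :=
  Finite.of_surjective (fun α : Σ a b : V, a ⟶ b => Total.mk α.1 α.2.1 α.2.2)
    fun α => ⟨⟨α.left, α.right, α.hom⟩, rfl⟩

instance (W : WideSubquiver V) [∀ a b : V, Finite (a ⟶ b)] (a b : W) : Finite (a ⟶ b) :=
  inferInstanceAs (Finite {α : (show V from a) ⟶ (show V from b) // α ∈ W a b})

instance (Q : Subquiver V) [∀ a b : V, Finite (a ⟶ b)] (a b : Q.Vert) : Finite (a ⟶ b) :=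
  Subtype.finite

theorem finrank_cycles [Finite V] [∀ a b : V, Finite (a ⟶ b)] :
    (Module.finrank ℤ (cycles V) : ℤ) = betti V := by
  have hboundary := finrank_range_add_finrank_ker (boundary V)
  have hcomponents := finrank_range_add_finrank_ker
    (Finsupp.lmapDomain ℤ ℤ (WeaklyConnectedComponent.mk (V := V)))
  have hsurj : LinearMap.range (Finsupp.lmapDomain ℤ ℤ (WeaklyConnectedComponent.mk (V := V))) =
      ⊤ :=
    LinearMap.range_eq_top.2 <| Finsupp.mapDomain_surjective fun c => ⟨_, mk_componentBase c⟩
  have := Fintype.ofFinite V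
  have := Fintype.ofFinite (Total V)
  have := Fintype.ofFinite (WeaklyConnectedComponent V)
  rw [hsurj, finrank_top, ← range_boundary, Module.finrank_finsupp_self,
    Module.finrank_finsupp_self] at hcomponents
  rw [Module.finrank_finsupp_self] at hboundary
  rw [betti, cycles, Nat.card_eq_fintype_card, Nat.card_eq_fintype_card,
    Nat.card_eq_fintype_card, ← hboundary, ← hcomponents]
  push_cast
  ring

theorem Subquiver.betti_relQuiver [Finite V] [∀ a b : V, Finite (a ⟶ b)] {Q : Subquiver V}
    {T : WideSubquiver V} (hT : IsMaximalForest (Q.treePart T) Q.arrows) :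
    betti (Q.relQuiver T) = betti V - betti Q.Vert := by
  have : Finite (Q.relQuiver T) := ‹Finite V›
  have hincl := LinearMap.finrank_range_of_inj (cyclesMap_injective Q.mapTotal_incl_injective)
  have hrel := LinearMap.finrank_range_of_inj
    (cyclesMap_injective (mapTotal_wideIncl_injective (Q.relQuiver T)))
  have hsum := (Submodule.prodEquivOfIsCompl _ _ (Q.isCompl_range_cyclesMap hT)).finrank_eq
  rw [Module.finrank_prod] at hsum
  rw [← finrank_cycles, ← finrank_cycles, ← finrank_cycles]
  lia

end Betti

/-! ### Monomial ideals -/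

section MonomialIdeals

variable {k : Type*} {V : Type*} [Field k] [Quiver V]

variable (k V) in
/-- The basis of the path algebra formed by the paths. -/
def pathBasis : Module.Basis (AnyPath V) k (PathAlgebra k V) :=
  .ofRepr (LinearEquiv.refl k (AnyPath V →₀ k))

theorem pathBasis_apply (p : AnyPath V) : pathBasis k V p = PathAlgebra.path k p := rfl

variable (k) in
/-- The span of a set of paths. -/
def spanPaths (S : Set (AnyPath V)) : Submodule k (PathAlgebra k V) :=
  Submodule.span k (PathAlgebra.path k '' S)

theorem mem_spanPaths {S : Set (AnyPath V)} {x : PathAlgebra k V} :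
    x ∈ spanPaths k S ↔ ∀ p ∈ x.toFinsupp.support, p ∈ S :=
  (pathBasis k V).mem_span_image

theorem path_mem_spanPaths {S : Set (AnyPath V)} {p : AnyPath V} (hp : p ∈ S) :
    PathAlgebra.path k p ∈ spanPaths k S :=
  Submodule.subset_span ⟨p, hp, rfl⟩

theorem spanPaths_univ : spanPaths k (Set.univ : Set (AnyPath V)) = ⊤ :=
  top_le_iff.1 fun _ _ => mem_spanPaths.2 fun _ _ => trivial

variable [Fintype V]

theorem spanPaths_mul_le {S S' S'' : Set (AnyPath V)}
    (h : ∀ {a b c : V} (p : Path a b) (q : Path b c),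
      ⟨b, c, q⟩ ∈ S → ⟨a, b, p⟩ ∈ S' → ⟨a, c, p.comp q⟩ ∈ S'') :
    spanPaths k S * spanPaths k S' ≤ spanPaths k S'' := by
  rw [spanPaths, spanPaths, Submodule.span_mul_span, Submodule.span_le]
  rintro _ ⟨_, ⟨⟨b, c, q⟩, hq, rfl⟩, _, ⟨⟨a, b', p⟩, hp, rfl⟩, rfl⟩
  change PathAlgebra.path k _ * PathAlgebra.path k _ ∈ _
  rw [PathAlgebra.path_mul_path]
  by_cases hb : b' = b
  · subst hb
    rw [PathAlgebra.mulPath_comp]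
    exact path_mem_spanPaths (h p q hq hp)
  · rw [PathAlgebra.mulPath_of_ne hb]
    exact zero_mem _

variable {I : TwoSidedIdeal (PathAlgebra k V)}

theorem smul_mem_twoSidedIdeal (c : k) {x : PathAlgebra k V} (hx : x ∈ I) : c • x ∈ I :=
  smul_one_mul c x ▸ I.mul_mem_left _ _ hx

theorem path_comp_mem_left {a b c : V} (p : Path a b) {q : Path b c}
    (hq : PathAlgebra.path k ⟨b, c, q⟩ ∈ I) : PathAlgebra.path k ⟨a, c, p.comp q⟩ ∈ I := by
  rw [← PathAlgebra.mulPath_comp, ← PathAlgebra.path_mul_path]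
  exact I.mul_mem_right _ _ hq

theorem path_comp_mem_right {a b c : V} {p : Path a b} (q : Path b c)
    (hp : PathAlgebra.path k ⟨a, b, p⟩ ∈ I) : PathAlgebra.path k ⟨a, c, p.comp q⟩ ∈ I := by
  rw [← PathAlgebra.mulPath_comp, ← PathAlgebra.path_mul_path]
  exact I.mul_mem_left _ _ hp

/-- The linear combinations of the paths that lie in `I` form an ideal, which contains any set of
paths that generates `I`. -/
theorem IsMonomialIdeal.mem_spanPaths (hI : IsMonomialIdeal I) {x : PathAlgebra k V} (hx : x ∈ I) :
    x ∈ spanPaths k {p | PathAlgebra.path k p ∈ I} := by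
  obtain ⟨Z, -, hZ⟩ := hI
  set N : Submodule k (PathAlgebra k V) := spanPaths k {p | PathAlgebra.path k p ∈ I}
  have hleft : spanPaths k Set.univ * N ≤ N :=
    spanPaths_mul_le fun _ q _ hp => path_comp_mem_right q hp
  have hright : N * spanPaths k Set.univ ≤ N :=
    spanPaths_mul_le fun p _ hq _ => path_comp_mem_left p hq
  rw [spanPaths_univ] at hleft hright
  let K : TwoSidedIdeal (PathAlgebra k V) := .mk' N N.zero_mem N.add_mem N.neg_mem
    (fun hy => hleft (Submodule.mul_mem_mul trivial hy))
    (fun hy => hright (Submodule.mul_mem_mul hy trivial))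
  have hIK : I ≤ K := by
    conv_lhs => rw [hZ]
    refine TwoSidedIdeal.span_le.2 ?_
    rintro _ ⟨p, hp, rfl⟩
    refine (TwoSidedIdeal.mem_mk' ..).2 (path_mem_spanPaths ?_)
    exact hZ ▸ TwoSidedIdeal.subset_span ⟨p, hp, rfl⟩
  exact (TwoSidedIdeal.mem_mk' ..).1 (hIK hx)

theorem IsMonomialIdeal.path_mem (hI : IsMonomialIdeal I) {x : PathAlgebra k V} (hx : x ∈ I)
    {p : AnyPath V} (hp : x.toFinsupp p ≠ 0) : PathAlgebra.path k p ∈ I :=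
  QuiverAlg.mem_spanPaths.1 (hI.mem_spanPaths hx) p (Finsupp.mem_support_iff.2 hp)

theorem IsMonomialIdeal.eq_of_isMinimalRelation (hI : IsMonomialIdeal I) {r : PathAlgebra k V}
    (hr : IsMinimalRelation I r) {p q : AnyPath V} (hp : r.toFinsupp p ≠ 0)
    (hq : r.toFinsupp q ≠ 0) : q = p := by
  classical
  have hfilter : r.toFinsupp.filter (· ∈ ({p} : Set (AnyPath V))) =
      r.toFinsupp p • Finsupp.single p 1 := by
    ext s
    by_cases hs : s = p
    · subst hs
      simp
    · simp [hs]
  have hmem : PathAlgebra.ofFinsupp (r.toFinsupp.filter (· ∈ ({p} : Set (AnyPath V)))) ∈ I := by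
    rw [hfilter]
    exact smul_mem_twoSidedIdeal _ (hI.path_mem hr.1 hp)
  by_contra hne
  rcases hr.2.2 {p} (by convert hmem) with h | h
  · refine hp ?_
    simpa using DFunLike.congr_fun h p
  · refine hq ?_
    simpa [hne, eq_comm] using DFunLike.congr_fun h q

theorem isMonomialIdeal_bot : IsMonomialIdeal (⊥ : TwoSidedIdeal (PathAlgebra k V)) :=
  ⟨∅, fun _ h => h.elim, by
    rw [Set.image_empty]
    exact le_antisymm bot_le (TwoSidedIdeal.span_le.2 (Set.empty_subset _))⟩

theorem Homotopic.chain_eq (hI : IsMonomialIdeal I) {a b : V} {u w : Walk a b}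
    (h : Homotopic I u w) : u.chain = w.chain := by
  induction h with
  | refl => rfl
  | symm _ ih => exact ih.symm
  | trans _ _ ih ih' => exact ih.trans ih'
  | comp _ _ ih ih' => rw [Walk.chain_comp, Walk.chain_comp, ih, ih']
  | inv_arrow α =>
    rw [Walk.chain_comp, Walk.chain_arrow, Walk.chain_invArrow, add_neg_cancel, Walk.chain_nil]
  | arrow_inv α =>
    rw [Walk.chain_comp, Walk.chain_arrow, Walk.chain_invArrow, neg_add_cancel, Walk.chain_nil]
  | rel p q r hr hp hq =>
    obtain rfl : q = p := by simpa using hI.eq_of_isMinimalRelation hr hp hq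
    rfl

end MonomialIdeals

/-! ### The abelianized fundamental group of a monomial bound quiver -/

section AbelianizedPi1

variable {k : Type w} {V : Type u} [Field k] [Quiver.{v} V] [Fintype V]
  {I : TwoSidedIdeal (PathAlgebra k V)}

theorem Pi1.mk_surjective {x : V} : Function.Surjective (Pi1.mk I (x := x)) :=
  Quotient.mk_surjective

/-- The homomorphism that maps the class of a closed walk to its cycle. -/
def Pi1.chainHom (hI : IsMonomialIdeal I) (x : V) : Pi1 I x →* Multiplicative (cycles V) where
  toFun := Quotient.lift (fun u => .ofAdd ⟨u.chain, u.chain_mem_cycles⟩)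
    fun _ _ h => congrArg Multiplicative.ofAdd (Subtype.ext (h.chain_eq hI))
  map_one' := congrArg Multiplicative.ofAdd (Subtype.ext (Walk.chain_nil x))
  map_mul' := by
    rintro ⟨u⟩ ⟨w⟩
    exact congrArg Multiplicative.ofAdd
      (Subtype.ext ((Walk.chain_comp w u).trans (add_comm _ _)))

theorem Pi1.chainHom_mk (hI : IsMonomialIdeal I) {x : V} (u : Walk x x) :
    Pi1.chainHom hI x (Pi1.mk I u) = .ofAdd ⟨u.chain, u.chain_mem_cycles⟩ := rfl

variable (base : WeaklyConnectedComponent V → V)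

/-- The total cycle of a family of closed walks, one for each connected component. -/
def prodChain (hI : IsMonomialIdeal I) :
    Abelianization (∀ c, Pi1 I (base c)) →* Multiplicative (cycles V) :=
  letI := Fintype.ofFinite (WeaklyConnectedComponent V)
  Abelianization.lift (∏ c, (Pi1.chainHom hI (base c)).comp (Pi.evalMonoidHom _ c))

theorem prodChain_of [Fintype (WeaklyConnectedComponent V)] (hI : IsMonomialIdeal I)
    (g : ∀ c, Pi1 I (base c)) :
    prodChain base hI (.of g) = ∏ c, Pi1.chainHom hI (base c) (g c) := by
  rw [prodChain, Abelianization.lift_apply_of, MonoidHom.finsetProd_apply]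
  simp only [MonoidHom.comp_apply, Pi.evalMonoidHom_apply]
  congr!

open Classical in
theorem prodChain_mulSingle (hI : IsMonomialIdeal I) (c : WeaklyConnectedComponent V)
    (g : Pi1 I (base c)) :
    prodChain base hI (.of (Pi.mulSingle c g)) = Pi1.chainHom hI (base c) g := by
  have := Fintype.ofFinite (WeaklyConnectedComponent V)
  rw [prodChain_of, Finset.prod_eq_single c, Pi.mulSingle_eq_same]
  · intro d _ hd
    rw [Pi.mulSingle_eq_of_ne hd, map_one]
  · exact fun h => absurd (Finset.mem_univ c) h

variable {base} (hbase : ∀ c, WeaklyConnectedComponent.mk (base c) = c)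

/-- A chosen walk from the base point of a component to a vertex of that component. -/
def walkFromBase {b : V} {c : WeaklyConnectedComponent V}
    (hb : WeaklyConnectedComponent.mk b = c) : Walk (base c) b :=
  (component_eq_iff.1 ((hbase c).trans hb.symm)).some

omit [Fintype V] in
theorem component_eq_of_walk {a b : V} {c : WeaklyConnectedComponent V}
    (ha : WeaklyConnectedComponent.mk a = c) (u : Walk a b) :
    WeaklyConnectedComponent.mk b = c :=
  (component_eq_iff.2 ⟨u.inv⟩).trans ha

/-- The closed walk at the base point obtained from a walk in the component `c` by adding the chosen
walks to its ends. -/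
def closeUp {a b : V} {c : WeaklyConnectedComponent V} (ha : WeaklyConnectedComponent.mk a = c)
    (u : Walk a b) : Walk (base c) (base c) :=
  ((walkFromBase hbase ha).comp u).comp (walkFromBase hbase (component_eq_of_walk ha u)).inv

open Classical in
variable (I) in
/-- The class of the closed walk `closeUp u` in the abelianized fundamental group of the whole
bound quiver, written additively. -/
def loopClass {a b : V} {c : WeaklyConnectedComponent V} (ha : WeaklyConnectedComponent.mk a = c)
    (u : Walk a b) : Additive (Abelianization (∀ c, Pi1 I (base c))) :=
  .ofMul (.of (Pi.mulSingle c (Pi1.mk I (closeUp hbase ha u))))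

variable {a b d : V} {c : WeaklyConnectedComponent V} (ha : WeaklyConnectedComponent.mk a = c)

theorem loopClass_congr {u u' : Walk a b} (h : Homotopic I u u') :
    loopClass I hbase ha u = loopClass I hbase ha u' := by
  rw [loopClass, loopClass, closeUp, closeUp,
    Pi1.mk_eq I (((Homotopic.refl _).comp h).comp (Homotopic.refl _))]

open Classical in
theorem loopClass_comp (u : Walk a b) (u' : Walk b d) :
    loopClass I hbase ha (u.comp u') =
      loopClass I hbase ha u + loopClass I hbase (component_eq_of_walk ha u) u' := by
  have hcomp : Pi1.mk I (closeUp hbase ha (u.comp u')) =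
      Pi1.mk I (closeUp hbase (component_eq_of_walk ha u) u') * Pi1.mk I (closeUp hbase ha u) := by
    rw [Pi1.mk_mul]
    refine Pi1.mk_eq I (Homotopic.symm ?_)
    rw [closeUp, closeUp, closeUp, Walk.comp_assoc _ u', ← Walk.comp_assoc _ u u',
      Walk.comp_assoc (.comp _ u) u']
    exact Homotopic.cancel_mid I (Homotopic.inv_comp I _)
  rw [loopClass, hcomp, Pi.mulSingle_mul, map_mul, ofMul_mul, add_comm]
  rfl

theorem loopClass_nil : loopClass I hbase ha (.nil a) = 0 :=
  left_eq_add.1 (loopClass_comp hbase ha (.nil a) (.nil a))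

theorem loopClass_invArrow (α : b ⟶ a) :
    loopClass I hbase ha (.invArrow α) =
      -loopClass I hbase (component_eq_of_walk ha (.invArrow α)) (.arrow α) := by
  rw [eq_neg_iff_add_eq_zero, ← loopClass_nil hbase ha, ← loopClass_congr hbase ha
    (Homotopic.arrow_inv α), loopClass_comp]

variable (I) in
/-- The linear extension of `loopClass` from arrows to chains. -/
def chainClass :
    (Total V →₀ ℤ) →ₗ[ℤ] Additive (Abelianization (∀ c, Pi1 I (base c))) :=
  Finsupp.linearCombination ℤ fun α => loopClass I hbase rfl (.arrow α.hom)

theorem chainClass_single_arrow (α : a ⟶ b) :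
    chainClass I hbase (.single (.mk a b α) 1) = loopClass I hbase ha (.arrow α) := by
  subst ha
  rw [chainClass, Finsupp.linearCombination_single, one_smul]

theorem chainClass_chain (u : Walk a b) :
    chainClass I hbase u.chain = loopClass I hbase ha u := by
  induction u using Walk.induction with
  | nil => rw [Walk.chain_nil, map_zero, loopClass_nil]
  | arrow u α ih =>
    rw [Walk.chain_comp, map_add, ih, loopClass_comp, Walk.chain_arrow, chainClass_single_arrow]
  | invArrow u α ih =>
    rw [Walk.chain_comp, map_add, ih, loopClass_comp, Walk.chain_invArrow, map_neg,
      loopClass_invArrow, chainClass_single_arrow]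

open Classical in
theorem loopClass_base (u : Walk (base c) (base c)) :
    loopClass I hbase (hbase c) u = .ofMul (.of (Pi.mulSingle c (Pi1.mk I u))) := by
  have hconj : Pi1.mk I (closeUp hbase (hbase c) u) =
      (Pi1.mk I (walkFromBase hbase (hbase c)))⁻¹ * Pi1.mk I u *
        Pi1.mk I (walkFromBase hbase (hbase c)) := by
    rw [Pi1.mk_inv, Pi1.mk_mul, Pi1.mk_mul, closeUp, Walk.comp_assoc]
  rw [loopClass, hconj, Pi.mulSingle_mul, Pi.mulSingle_mul, Pi.mulSingle_inv]
  refine congrArg Additive.ofMul ?_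
  rw [map_mul, map_mul, map_inv, inv_mul_cancel_comm]

theorem chainClass_prodChain (hI : IsMonomialIdeal I)
    (g : Abelianization (∀ c, Pi1 I (base c))) :
    chainClass I hbase (prodChain base hI g).toAdd = .ofMul g := by
  classical
  suffices h : (AddMonoidHom.toMultiplicativeLeft
      ((chainClass I hbase).comp (cycles V).subtype).toAddMonoidHom).comp (prodChain base hI) =
        MonoidHom.id _ from congrArg Additive.ofMul (DFunLike.congr_fun h g)
  refine Abelianization.hom_ext _ _ (MonoidHom.pi_ext fun c g => ?_)
  obtain ⟨u, rfl⟩ := Pi1.mk_surjective g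
  rw [MonoidHom.comp_apply, MonoidHom.comp_apply, prodChain_mulSingle, Pi1.chainHom_mk]
  exact congrArg Additive.toMul
    ((chainClass_chain hbase (hbase c) u).trans (loopClass_base hbase u))

theorem prodChain_loopClass (hI : IsMonomialIdeal I) (u : Walk a b) :
    ((prodChain base hI (loopClass I hbase ha u).toMul).toAdd : Total V →₀ ℤ) =
      u.chain - ((walkFromBase hbase (component_eq_of_walk ha u)).chain -
        (walkFromBase hbase ha).chain) := by
  rw [loopClass, toMul_ofMul, prodChain_mulSingle, Pi1.chainHom_mk, toAdd_ofAdd]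
  simp only [closeUp, Walk.chain_comp, Walk.chain_inv]
  abel

theorem prodChain_chainClass (hI : IsMonomialIdeal I) (z : Total V →₀ ℤ) :
    ((prodChain base hI (chainClass I hbase z).toMul).toAdd : Total V →₀ ℤ) =
      z - Finsupp.linearCombination ℤ (fun b => (walkFromBase hbase (b := b) rfl).chain)
        (boundary V z) := by
  induction z using Finsupp.induction_linear with
  | zero => simp
  | add x y hx hy =>
    rw [map_add, toMul_add, map_mul, toAdd_mul, Submodule.coe_add, hx, hy, map_add, map_add,
      add_sub_add_comm]
  | single α n =>
    have hn : (.single α n : Total V →₀ ℤ) = n • .single α 1 := by simp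
    have hright : ∀ {c} (h : WeaklyConnectedComponent.mk α.right = c),
        (walkFromBase hbase (b := α.right) rfl).chain = (walkFromBase hbase h).chain := by
      rintro _ rfl
      rfl
    rw [hn, map_smul, toMul_zsmul, map_zpow, toAdd_zpow, Submodule.coe_smul,
      chainClass_single_arrow hbase rfl, prodChain_loopClass, Walk.chain_arrow, map_smul, map_smul,
      boundary_single, map_sub, Finsupp.linearCombination_single,
      Finsupp.linearCombination_single, one_smul, one_smul, ← smul_sub,
      hright (component_eq_of_walk rfl (.arrow α.hom))]

include hbase in
theorem prodChain_bijective (hI : IsMonomialIdeal I) : Function.Bijective (prodChain base hI) := by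
  refine ⟨fun g g' h => Additive.ofMul.injective ?_, fun z => ?_⟩
  · rw [← chainClass_prodChain hbase hI, h, chainClass_prodChain hbase hI]
  · refine ⟨(chainClass I hbase z.toAdd).toMul, Multiplicative.toAdd.injective (Subtype.ext ?_)⟩
    rw [prodChain_chainClass, mem_cycles.1 z.toAdd.2, map_zero, sub_zero]

/-- The cycle of an element of the abelianized fundamental group. -/
def abChain (hI : IsMonomialIdeal I) (x : V) :
    Abelianization (Pi1 I x) →* Multiplicative (cycles V) :=
  Abelianization.lift (Pi1.chainHom hI x)

theorem abChain_of (hI : IsMonomialIdeal I) {x : V} (g : Pi1 I x) :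
    abChain hI x (.of g) = Pi1.chainHom hI x g := rfl

theorem abChain_bijective (hI : IsMonomialIdeal I) {x : V} (hx : ∀ y : V, Nonempty (Walk x y)) :
    Function.Bijective (abChain hI x) := by
  have hbase : ∀ c : WeaklyConnectedComponent V, WeaklyConnectedComponent.mk x = c := fun c =>
    (component_eq_iff.2 (hx _)).trans (mk_componentBase c)
  let _ : Unique (WeaklyConnectedComponent V) := ⟨⟨.mk x⟩, fun c => (hbase c).symm⟩
  let e := (MulEquiv.piUnique fun _ : WeaklyConnectedComponent V => Pi1 I x).symm
  have hcomp : abChain hI x =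
      (prodChain (fun _ => x) hI).comp e.abelianizationCongr.toMonoidHom := by
    refine Abelianization.hom_ext _ _ (MonoidHom.ext fun g => ?_)
    rw [MonoidHom.comp_apply, MonoidHom.comp_apply, abChain_of]
    exact ((prodChain_of _ hI (e g)).trans (Fintype.prod_unique _)).symm
  rw [hcomp]
  exact (prodChain_bijective hbase hI).comp e.abelianizationCongr.bijective

end AbelianizedPi1

/-! ### The map induced by a subquiver -/

section AbMap

variable {k : Type w} {V : Type u} [Field k] [Quiver.{v} V] [Fintype V]
  {Q : Subquiver V} {I' : TwoSidedIdeal (PathAlgebra k Q.Vert)}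
  {I : TwoSidedIdeal (PathAlgebra k V)} (hc : Q.Compatible I' I) {x₀ : V}

omit [Fintype V] in
theorem Subquiver.chain_mapWalk {a b : Q.Vert} (u : Walk a b) :
    (Q.mapWalk u).chain = u.chain.mapDomain (mapTotal Q.incl) :=
  Walk.chain_map Q.incl u

theorem Subquiver.chainHom_pi1Map (hI' : IsMonomialIdeal I') (hI : IsMonomialIdeal I)
    {y : Q.Vert} (γ : Walk x₀ y.1) (g : Pi1 I' y) :
    Pi1.chainHom hI x₀ (Subquiver.pi1Map hc γ g) =
      (cyclesMap Q.incl).toAddMonoidHom.toMultiplicative (Pi1.chainHom hI' y g) := by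
  obtain ⟨u, rfl⟩ := Pi1.mk_surjective g
  refine congrArg Multiplicative.ofAdd (Subtype.ext ?_)
  change ((γ.comp (Q.mapWalk u)).comp γ.inv).chain = u.chain.mapDomain (mapTotal Q.incl)
  rw [Walk.chain_comp, Walk.chain_comp, Walk.chain_inv, Q.chain_mapWalk, add_neg_cancel_comm]

variable (γ : ∀ c : WeaklyConnectedComponent Q.Vert, Walk x₀ (componentBase c).1)

theorem Subquiver.abMap_of [Fintype (WeaklyConnectedComponent Q.Vert)] (g : Pi1Prod I') :
    Subquiver.abMap hc γ (.of g) = ∏ c, .of (Subquiver.pi1Map hc (γ c) (g c)) := by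
  rw [Subquiver.abMap, Abelianization.lift_apply_of, MonoidHom.finsetProd_apply]
  simp only [MonoidHom.comp_apply, Pi.evalMonoidHom_apply]
  congr!

theorem Subquiver.abChain_comp_abMap (hI' : IsMonomialIdeal I') (hI : IsMonomialIdeal I) :
    (abChain hI x₀).comp (Subquiver.abMap hc γ) =
      (cyclesMap Q.incl).toAddMonoidHom.toMultiplicative.comp (prodChain componentBase hI') := by
  have := Fintype.ofFinite (WeaklyConnectedComponent Q.Vert)
  refine Abelianization.hom_ext _ _ (MonoidHom.ext fun g => ?_)
  simp only [MonoidHom.comp_apply, Subquiver.abMap_of, prodChain_of, map_prod, abChain_of,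
    Subquiver.chainHom_pi1Map hc hI' hI]

theorem Subquiver.abMap_injective (hI' : IsMonomialIdeal I') (hI : IsMonomialIdeal I) :
    Function.Injective (Subquiver.abMap hc γ) := by
  refine Function.Injective.of_comp (f := abChain hI x₀) ?_
  rw [← MonoidHom.coe_comp, Subquiver.abChain_comp_abMap hc γ hI' hI, MonoidHom.coe_comp]
  exact (cyclesMap_injective Q.mapTotal_incl_injective).comp
    (prodChain_bijective mk_componentBase hI').1

theorem Subquiver.mem_range_abMap (hI' : IsMonomialIdeal I') (hI : IsMonomialIdeal I)
    (hx : ∀ y : V, Nonempty (Walk x₀ y)) {g : Abelianization (Pi1 I x₀)} :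
    g ∈ (Subquiver.abMap hc γ).range ↔
      (abChain hI x₀ g).toAdd ∈ LinearMap.range (cyclesMap Q.incl) := by
  have hsquare := DFunLike.congr_fun (Subquiver.abChain_comp_abMap hc γ hI' hI)
  constructor
  · rintro ⟨g', rfl⟩
    exact ⟨_, (hsquare g').symm⟩
  · rintro ⟨z, hz⟩
    obtain ⟨g', hg'⟩ := (prodChain_bijective mk_componentBase hI').2 (.ofAdd z)
    refine ⟨g', (abChain_bijective hI hx).1 ((hsquare g').trans ?_)⟩
    rw [MonoidHom.comp_apply, hg']
    exact congrArg Multiplicative.ofAdd hz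

theorem Subquiver.map_contractionSubgroup (hI' : IsMonomialIdeal I') (hI : IsMonomialIdeal I)
    (hx : ∀ y : V, Nonempty (Walk x₀ y)) :
    (Q.contractionSubgroup I x₀).map Abelianization.of = (Subquiver.abMap hc γ).range := by
  apply le_antisymm
  · rw [Subquiver.contractionSubgroup, Subgroup.map_le_iff_le_comap, Subgroup.closure_le]
    rintro _ ⟨a, b, u, u', z, rfl⟩
    refine (Subquiver.mem_range_abMap hc γ hI' hI hx).2
      ⟨⟨(u.comp u'.inv).chain, (u.comp u'.inv).chain_mem_cycles⟩, Subtype.ext ?_⟩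
    change (u.comp u'.inv).chain.mapDomain (mapTotal Q.incl) =
      (((z.comp (Q.mapWalk u)).comp (Q.mapWalk u').inv).comp z.inv).chain
    rw [← Q.chain_mapWalk, Q.mapWalk_comp]
    have hinv : (Q.mapWalk u'.inv).chain = (Q.mapWalk u').inv.chain := by
      rw [Walk.chain_inv, Q.chain_mapWalk, Q.chain_mapWalk, Walk.chain_inv]
      exact map_neg (Finsupp.mapDomain.addMonoidHom _) _
    simp only [Walk.chain_comp, hinv, Walk.chain_inv z]
    abel
  · have := Fintype.ofFinite (WeaklyConnectedComponent Q.Vert)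
    rintro _ ⟨⟨g⟩, rfl⟩
    refine (Subquiver.abMap_of hc γ g).symm ▸ prod_mem fun c _ =>
      Subgroup.mem_map_of_mem _ (Subgroup.subset_closure ?_)
    obtain ⟨u, hu⟩ := Pi1.mk_surjective (g c)
    exact ⟨_, _, u, .nil _, γ c, congrArg (Subquiver.pi1Map hc (γ c)) hu.symm⟩

theorem Subquiver.nonempty_abelianization_relPi1_equiv (hI' : IsMonomialIdeal I')
    (hI : IsMonomialIdeal I) {T : WideSubquiver V} (hT : IsMaximalForest (Q.treePart T) Q.arrows)
    (hx : ∀ y : V, Nonempty (Walk x₀ y))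
    (hx' : ∀ y : Q.relQuiver T, Nonempty (Walk (toWide (Q.relQuiver T) x₀) y)) :
    Nonempty (Abelianization (Q.RelPi1 k T x₀) ≃*
      Abelianization (Pi1 I x₀) ⧸ (Subquiver.abMap hc γ).range) := by
  let i := cyclesMap (wideIncl (Q.relQuiver T))
  have hi : Function.Injective i := cyclesMap_injective (mapTotal_wideIncl_injective _)
  let proj := LinearMap.linearProjOfIsCompl _ i hi (Q.isCompl_range_cyclesMap hT).symm
  let f : Abelianization (Pi1 I x₀) →* Multiplicative (cycles (Q.relQuiver T)) :=
    proj.toAddMonoidHom.toMultiplicative.comp (abChain hI x₀)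
  have hproj : Function.Surjective proj := fun z =>
    ⟨i z, LinearMap.linearProjOfIsCompl_apply_left _ i hi _ z⟩
  have hf : Function.Surjective f := hproj.comp (abChain_bijective hI hx).2
  have hker : f.ker = (Subquiver.abMap hc γ).range := by
    ext g
    rw [Subquiver.mem_range_abMap hc γ hI' hI hx,
      ← LinearMap.ker_linearProjOfIsCompl _ i hi (Q.isCompl_range_cyclesMap hT).symm]
    rfl
  exact ⟨(MulEquiv.ofBijective (abChain isMonomialIdeal_bot _)
    (abChain_bijective isMonomialIdeal_bot hx')).trans
      ((QuotientGroup.quotientKerEquivOfSurjective f hf).symm.trans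
        (QuotientGroup.quotientMulEquivOfEq hker))⟩

end AbMap

/-- The abelianization of a quotient is the quotient of the abelianization by the image. -/
def abelianizationQuotientEquiv {G : Type*} [Group G] (N : Subgroup G) [N.Normal] :
    Abelianization (G ⧸ N) ≃* Abelianization G ⧸ N.map Abelianization.of :=
  MonoidHom.toMulEquiv
    (Abelianization.lift (QuotientGroup.lift N ((QuotientGroup.mk' _).comp Abelianization.of)
      fun g hg => (QuotientGroup.eq_one_iff _).2 (Subgroup.mem_map_of_mem _ hg)))
    (QuotientGroup.lift _ (Abelianization.map (QuotientGroup.mk' N)) (by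
      rw [Subgroup.map_le_iff_le_comap]
      intro g hg
      rw [Subgroup.mem_comap, MonoidHom.mem_ker, Abelianization.map_of, QuotientGroup.mk'_apply,
        (QuotientGroup.eq_one_iff g).2 hg, map_one]))
    (by ext; rfl) (by ext; rfl)

/-! ### Homomorphisms to the additive group of the field -/

section Dual

variable {k : Type w} [Field k]

/-- An identification of the abelianization of `G` with `Z` identifies the additive maps from `Z`
to `k` with the homomorphisms from `G` to `k⁺`. -/
def dualGroupEquiv {G Z : Type*} [Group G] [AddCommGroup Z]
    (e : Abelianization G ≃* Multiplicative Z) : (Z →ₗ[ℤ] k) ≃ₗ[k] DualGroup k G where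
  toFun ψ := ψ.toAddMonoidHom.comp
    (MonoidHom.toAdditiveLeft (e.toMonoidHom.comp Abelianization.of))
  invFun φ := (AddMonoidHom.toMultiplicative.symm ((Abelianization.lift
    (AddMonoidHom.toMultiplicativeRight φ)).comp e.symm.toMonoidHom)).toIntLinearMap
  map_add' _ _ := rfl
  map_smul' _ _ := rfl
  left_inv ψ := LinearMap.ext fun z => by
    obtain ⟨⟨g⟩, hg⟩ := e.surjective (.ofAdd z)
    obtain rfl : (e (.of g)).toAdd = z := congrArg Multiplicative.toAdd hg
    exact congrArg (fun a => Multiplicative.toAdd (Abelianization.lift _ a))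
      (e.symm_apply_apply (.of g))
  right_inv φ := AddMonoidHom.ext fun g =>
    congrArg (fun a => Multiplicative.toAdd (Abelianization.lift _ a))
      (e.symm_apply_apply (.of g.toMul))

theorem rank_dualGroup {G Z : Type*} [Group G] [AddCommGroup Z] [Module.Free ℤ Z]
    [Module.Finite ℤ Z] (e : Abelianization G ≃* Multiplicative Z) :
    Module.rank k (DualGroup k G) = Module.finrank ℤ Z := by
  have := Module.Finite.equiv (dualGroupEquiv (k := k) e)
  rw [← Module.finrank_eq_rank, ← (dualGroupEquiv e).finrank_eq, Module.finrank_linearMap_self]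

theorem rank_dualGroup_le_of_surjective {G H : Type u} [Group G] [Group H] {f : G →* H}
    (hf : Function.Surjective f) :
    Module.rank k (DualGroup k H) ≤ Module.rank k (DualGroup k G) := by
  let restrict : DualGroup k H →ₗ[k] DualGroup k G :=
    { toFun := fun φ => φ.comp (MonoidHom.toAdditive f)
      map_add' := fun _ _ => rfl
      map_smul' := fun _ _ => rfl }
  exact LinearMap.rank_le_of_injective restrict fun _ _ => (AddMonoidHom.cancel_right hf).1

variable {V : Type u} [Quiver.{v} V] [Fintype V] {I : TwoSidedIdeal (PathAlgebra k V)}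

theorem Homotopic.of_bot {a b : V} {u w : Walk a b}
    (h : Homotopic (⊥ : TwoSidedIdeal (PathAlgebra k V)) u w) : Homotopic I u w := by
  induction h with
  | refl u => exact .refl _
  | symm _ ih => exact ih.symm
  | trans _ _ ih ih' => exact ih.trans ih'
  | comp _ _ ih ih' => exact ih.comp ih'
  | inv_arrow α => exact .inv_arrow α
  | arrow_inv α => exact .arrow_inv α
  | rel p q r hr _ _ => exact absurd ((TwoSidedIdeal.mem_bot _).1 hr.1) hr.2.1

variable (I) in
/-- The projection from the fundamental group of a quiver to that of a bound quiver. -/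
def Pi1.ofBot (x : V) : Pi1 (⊥ : TwoSidedIdeal (PathAlgebra k V)) x →* Pi1 I x where
  toFun := Quotient.map id fun _ _ h => Homotopic.of_bot h
  map_one' := rfl
  map_mul' := by
    rintro ⟨u⟩ ⟨w⟩
    rfl

theorem Pi1.ofBot_surjective (x : V) : Function.Surjective (Pi1.ofBot I x) := by
  rintro ⟨u⟩
  exact ⟨Pi1.mk _ u, rfl⟩

variable [∀ a b : V, Finite (a ⟶ b)]

theorem rank_dualGroup_pi1Prod (hI : IsMonomialIdeal I) :
    Module.rank k (DualGroup k (Pi1Prod I)) = Module.finrank ℤ (cycles V) :=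
  rank_dualGroup (.ofBijective _ (prodChain_bijective mk_componentBase hI))

theorem rank_dualGroup_pi1Prod_le (I : TwoSidedIdeal (PathAlgebra k V)) :
    Module.rank k (DualGroup k (Pi1Prod I)) ≤ Module.finrank ℤ (cycles V) := by
  rw [← rank_dualGroup_pi1Prod (k := k) (V := V) isMonomialIdeal_bot]
  have hsurj : Function.Surjective
      (MonoidHom.piMap fun c => Pi1.ofBot I (componentBase (V := V) c)) :=
    Function.Surjective.piMap fun c => Pi1.ofBot_surjective _
  exact rank_dualGroup_le_of_surjective hsurj

theorem rank_dualGroup_pi1 (hI : IsMonomialIdeal I) {x : V} (hx : ∀ y : V, Nonempty (Walk x y)) :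
    Module.rank k (DualGroup k (Pi1 I x)) = Module.finrank ℤ (cycles V) :=
  rank_dualGroup (.ofBijective _ (abChain_bijective hI hx))

end Dual

/-! ### The Betti number as an invariant of the algebra -/

section LengthFiltration

variable {k : Type*} {V : Type*} [Field k] [Quiver V]

variable (k V) in
/-- The span of the paths of length at least `n`: the `n`-th power of the arrow ideal. -/
def lengthSpan (n : ℕ) : Submodule k (PathAlgebra k V) :=
  spanPaths k {p | n ≤ p.2.2.length}

theorem mem_lengthSpan {n : ℕ} {x : PathAlgebra k V} :
    x ∈ lengthSpan k V n ↔ ∀ p ∈ x.toFinsupp.support, n ≤ p.2.2.length :=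
  mem_spanPaths

theorem path_mem_lengthSpan {n : ℕ} {p : AnyPath V} :
    PathAlgebra.path k p ∈ lengthSpan k V n ↔ n ≤ p.2.2.length :=
  ⟨fun h => mem_lengthSpan.1 h p (by simp [PathAlgebra.path, PathAlgebra.toFinsupp,
    PathAlgebra.ofFinsupp]), fun h => path_mem_spanPaths h⟩

theorem lengthSpan_antitone : Antitone (lengthSpan k V) := fun _ _ hmn _ hx =>
  mem_lengthSpan.2 fun p hp => hmn.trans (mem_lengthSpan.1 hx p hp)

theorem mem_lengthSpan_zero (x : PathAlgebra k V) : x ∈ lengthSpan k V 0 :=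
  mem_lengthSpan.2 fun _ _ => Nat.zero_le _

variable (k) in
/-- The coefficients of an element of the path algebra at a family of paths. -/
def pathCoeffs {ι : Type*} (j : ι → AnyPath V) : PathAlgebra k V →ₗ[k] (ι → k) :=
  LinearMap.pi fun i => (pathBasis k V).coord (j i)

theorem pathCoeffs_surjective {ι : Type*} [Finite ι] {j : ι → AnyPath V}
    (hj : Function.Injective j) : Function.Surjective (pathCoeffs k j) := fun f =>
  ⟨PathAlgebra.ofFinsupp ((Finsupp.equivFunOnFinite.symm f).mapDomain j),
    funext fun i => Finsupp.mapDomain_apply hj _ i⟩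

theorem ker_pathCoeffs {ι : Type*} (j : ι → AnyPath V) :
    LinearMap.ker (pathCoeffs k j) = spanPaths k (Set.range j)ᶜ := by
  ext x
  rw [LinearMap.mem_ker, mem_spanPaths]
  constructor
  · rintro h p hp ⟨i, rfl⟩
    exact Finsupp.mem_support_iff.1 hp (congrFun h i)
  · intro h
    funext i
    by_contra hi
    exact h (j i) (Finsupp.mem_support_iff.2 hi) ⟨i, rfl⟩

/-- The trivial path at a vertex. -/
def trivialPath (a : V) : AnyPath V := ⟨a, a, Path.nil⟩

/-- An arrow, as a path. -/
def arrowPath (α : Total V) : AnyPath V := ⟨α.left, α.right, α.hom.toPath⟩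

theorem trivialPath_injective : Function.Injective (trivialPath (V := V)) :=
  fun _ _ h => congrArg Sigma.fst h

theorem arrowPath_injective : Function.Injective (arrowPath (V := V)) := by
  rintro ⟨a, b, α⟩ ⟨a', b', α'⟩ h
  obtain rfl : a = a' := congrArg Sigma.fst h
  obtain rfl : b = b' := congrArg (fun p : AnyPath V => p.2.1) h
  simpa [arrowPath, Hom.toPath] using h

theorem sumElim_trivialPath_arrowPath_injective :
    Function.Injective (Sum.elim (trivialPath (V := V)) arrowPath) :=
  trivialPath_injective.sumElim arrowPath_injective fun _ _ h =>
    zero_ne_one (congrArg (fun p : AnyPath V => p.2.2.length) h)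

theorem range_trivialPath :
    Set.range (trivialPath (V := V)) = {p | p.2.2.length < 1} := by
  refine Set.Subset.antisymm (Set.range_subset_iff.2 fun _ => Nat.zero_lt_one) ?_
  rintro ⟨a, b, _ | _⟩ h
  · exact ⟨a, rfl⟩
  · exact absurd (Nat.le_add_left 1 _) (not_le.2 h)

theorem range_sumElim_trivialPath_arrowPath :
    Set.range (Sum.elim (trivialPath (V := V)) arrowPath) = {p | p.2.2.length < 2} := by
  refine Set.Subset.antisymm (Set.range_subset_iff.2 ?_) ?_
  · rintro (_ | _)
    · exact Nat.zero_lt_two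
    · exact Nat.one_lt_two
  · rintro ⟨a, b, _ | ⟨_ | _, e⟩⟩ h
    · exact ⟨.inl a, rfl⟩
    · exact ⟨.inr ⟨_, _, e⟩, rfl⟩
    · exact absurd (Nat.le_add_left 2 _) (not_le.2 h)

variable [Fintype V]

theorem lengthSpan_mul_le (m n : ℕ) :
    lengthSpan k V m * lengthSpan k V n ≤ lengthSpan k V (m + n) :=
  spanPaths_mul_le fun p q hq hp => by
    rw [Set.mem_ofPred_eq, Path.length_comp, add_comm]
    exact add_le_add hp hq

theorem mul_mem_lengthSpan_left {n : ℕ} (x : PathAlgebra k V) {y : PathAlgebra k V}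
    (hy : y ∈ lengthSpan k V n) : x * y ∈ lengthSpan k V n := by
  simpa only [zero_add] using
    lengthSpan_mul_le 0 n (Submodule.mul_mem_mul (mem_lengthSpan_zero x) hy)

theorem mul_mem_lengthSpan_right {n : ℕ} {x : PathAlgebra k V} (hx : x ∈ lengthSpan k V n)
    (y : PathAlgebra k V) : x * y ∈ lengthSpan k V n :=
  lengthSpan_mul_le n 0 (Submodule.mul_mem_mul hx (mem_lengthSpan_zero y))

theorem lengthSpan_pow_le (m : ℕ) : lengthSpan k V 1 ^ m ≤ lengthSpan k V m := by
  induction m with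
  | zero => exact fun x _ => mem_lengthSpan_zero x
  | succ m ih =>
    rw [pow_succ]
    exact (mul_le_mul_left ih _).trans (lengthSpan_mul_le m 1)

theorem lengthSpan_one_mul_self : lengthSpan k V 1 * lengthSpan k V 1 = lengthSpan k V 2 := by
  refine le_antisymm (lengthSpan_mul_le 1 1) (Submodule.span_le.2 ?_)
  rintro _ ⟨⟨a, c, _ | ⟨p, e⟩⟩, hp, rfl⟩
  · exact absurd hp (Nat.not_succ_le_zero 1)
  · change PathAlgebra.path k ⟨a, c, p.comp e.toPath⟩ ∈ _
    rw [← PathAlgebra.mulPath_comp, ← PathAlgebra.path_mul_path]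
    exact Submodule.mul_mem_mul (path_mem_lengthSpan.2 (Nat.le_refl 1))
      (path_mem_lengthSpan.2 (Nat.le_of_succ_le_succ hp))

variable (k V) in
/-- The coefficients of an element of the path algebra at the trivial paths. -/
abbrev vertexCoeffs : PathAlgebra k V →ₗ[k] (V → k) := pathCoeffs k trivialPath

/-- The linear combination of trivial paths with given coefficients. -/
def vertexSum (f : V → k) : PathAlgebra k V := ∑ a, f a • PathAlgebra.path k (trivialPath a)

theorem vertexCoeffs_eq_zero {x : PathAlgebra k V} :
    vertexCoeffs k V x = 0 ↔ x ∈ lengthSpan k V 1 := by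
  rw [← LinearMap.mem_ker, ker_pathCoeffs, range_trivialPath, Set.compl_ofPred]
  simp only [not_lt, lengthSpan]

theorem vertexCoeffs_vertexSum (f : V → k) : vertexCoeffs k V (vertexSum f) = f := by
  classical
  funext b
  have hcoeff (a : V) : (pathBasis k V).coord (trivialPath b) (PathAlgebra.path k (trivialPath a)) =
      if a = b then 1 else 0 := by
    rw [← pathBasis_apply, Module.Basis.coord_apply, Module.Basis.repr_self_apply]
    simp only [trivialPath_injective.eq_iff]
  simp [pathCoeffs, vertexSum, hcoeff]

theorem sub_vertexSum_mem (x : PathAlgebra k V) :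
    x - vertexSum (vertexCoeffs k V x) ∈ lengthSpan k V 1 :=
  vertexCoeffs_eq_zero.1 (by rw [map_sub, vertexCoeffs_vertexSum, sub_self])

theorem vertexSum_mul_path (f : V → k) (p : AnyPath V) :
    vertexSum f * PathAlgebra.path k p = f p.2.1 • PathAlgebra.path k p := by
  rw [vertexSum, Finset.sum_mul, Finset.sum_eq_single_of_mem p.2.1 (Finset.mem_univ _)]
  · rw [PathAlgebra.smul_mul', PathAlgebra.path_mul_path]
    exact congrArg _ (PathAlgebra.mulPath_comp _ _)
  · intro b _ hb
    rw [PathAlgebra.smul_mul', PathAlgebra.path_mul_path, PathAlgebra.mulPath_of_ne hb.symm,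
      smul_zero]

theorem path_mul_vertexSum (f : V → k) (p : AnyPath V) :
    PathAlgebra.path k p * vertexSum f = f p.1 • PathAlgebra.path k p := by
  rw [vertexSum, Finset.mul_sum, Finset.sum_eq_single_of_mem p.1 (Finset.mem_univ _)]
  · rw [PathAlgebra.mul_smul', PathAlgebra.path_mul_path]
    refine congrArg _ ((PathAlgebra.mulPath_comp _ _).trans ?_)
    rw [Path.nil_comp]
  · intro b _ hb
    rw [PathAlgebra.mul_smul', PathAlgebra.path_mul_path, PathAlgebra.mulPath_of_ne hb, smul_zero]

theorem vertexSum_mul_vertexSum (f g : V → k) :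
    vertexSum f * vertexSum g = vertexSum (f * g) := by
  refine (Finset.mul_sum ..).trans (Finset.sum_congr rfl fun a _ => ?_)
  rw [PathAlgebra.mul_smul', vertexSum_mul_path, smul_smul, mul_comm]
  rfl

theorem mul_path_sub_mem (x : PathAlgebra k V) (p : AnyPath V) :
    x * PathAlgebra.path k p - vertexCoeffs k V x p.2.1 • PathAlgebra.path k p ∈
      lengthSpan k V (1 + p.2.2.length) := by
  rw [← vertexSum_mul_path, ← sub_mul]
  exact lengthSpan_mul_le _ _ (Submodule.mul_mem_mul (sub_vertexSum_mem x)
    (path_mem_lengthSpan.2 le_rfl))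

theorem path_mul_sub_mem (x : PathAlgebra k V) (p : AnyPath V) :
    PathAlgebra.path k p * x - vertexCoeffs k V x p.1 • PathAlgebra.path k p ∈
      lengthSpan k V (p.2.2.length + 1) := by
  rw [← path_mul_vertexSum, ← mul_sub]
  exact lengthSpan_mul_le _ _ (Submodule.mul_mem_mul (path_mem_lengthSpan.2 le_rfl)
    (sub_vertexSum_mem x))

theorem vertexCoeffs_one : vertexCoeffs k V 1 = 1 := by
  have hone : (1 : PathAlgebra k V) = vertexSum 1 :=
    Finset.sum_congr rfl fun _ _ => (one_smul k _).symm
  rw [hone, vertexCoeffs_vertexSum]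

theorem vertexCoeffs_mul (x y : PathAlgebra k V) :
    vertexCoeffs k V (x * y) = vertexCoeffs k V x * vertexCoeffs k V y := by
  have hsub : x * y - vertexSum (vertexCoeffs k V x) * vertexSum (vertexCoeffs k V y) ∈
      lengthSpan k V 1 := by
    rw [← sub_add_sub_cancel _ (vertexSum (vertexCoeffs k V x) * y), ← sub_mul, ← mul_sub]
    exact add_mem (mul_mem_lengthSpan_right (sub_vertexSum_mem x) y)
      (mul_mem_lengthSpan_left _ (sub_vertexSum_mem y))
  rwa [vertexSum_mul_vertexSum, ← vertexCoeffs_eq_zero, map_sub, vertexCoeffs_vertexSum,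
    sub_eq_zero] at hsub

theorem mem_lengthSpan_one_of_pow_mem {x : PathAlgebra k V} {n : ℕ}
    (hx : x ^ n ∈ lengthSpan k V 1) : x ∈ lengthSpan k V 1 := by
  let φ : PathAlgebra k V →ₐ[k] (V → k) :=
    .ofLinearMap (vertexCoeffs k V) vertexCoeffs_one vertexCoeffs_mul
  have hpow : φ x ^ n = 0 := (map_pow φ x n).symm.trans (vertexCoeffs_eq_zero.2 hx)
  exact vertexCoeffs_eq_zero.1 (eq_zero_of_pow_eq_zero hpow)

end LengthFiltration

section Invariants

/-- The span of the nilpotent elements of an algebra. For a bound quiver algebra it is the Jacobson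
radical. -/
def nilSpan (k : Type*) (A : Type*) [Field k] [Ring A] [Algebra k A] : Submodule k A :=
  Submodule.span k {x | IsNilpotent x}

/-- The image of the center of an algebra in the quotient by the span of the nilpotents. -/
def centerImage (k : Type*) (A : Type*) [Field k] [Ring A] [Algebra k A] :
    Submodule k (A ⧸ nilSpan k A) :=
  (Subalgebra.toSubmodule (Subalgebra.center k A)).map (nilSpan k A).mkQ

/-- The first Betti number of the quiver of a bound quiver algebra, expressed through the algebra
alone. With `r` the radical, `A / r²` counts vertices and arrows, `A / r` counts vertices, and the
image of the center in `A / r` counts connected components. -/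
def algebraBetti (k : Type*) (A : Type*) [Field k] [Ring A] [Algebra k A] : ℤ :=
  Module.finrank k (A ⧸ nilSpan k A * nilSpan k A) - 2 * Module.finrank k (A ⧸ nilSpan k A) +
    Module.finrank k (centerImage k A)

theorem exists_linearEquiv_of_ker_eq {R M N P : Type*} [Ring R] [AddCommGroup M]
    [AddCommGroup N] [AddCommGroup P] [Module R M] [Module R N] [Module R P] {f : M →ₗ[R] N}
    {g : M →ₗ[R] P} (hf : Function.Surjective f) (hg : Function.Surjective g)
    (hker : LinearMap.ker f = LinearMap.ker g) : ∃ e : N ≃ₗ[R] P, ∀ x, e (f x) = g x := by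
  refine ⟨(f.quotKerEquivOfSurjective hf).symm.trans ((Submodule.quotEquivOfEq _ _ hker).trans
    (g.quotKerEquivOfSurjective hg)), fun x => ?_⟩
  have hx : (f.quotKerEquivOfSurjective hf).symm (f x) = Submodule.Quotient.mk x :=
    (LinearEquiv.symm_apply_eq _).2 rfl
  rw [LinearEquiv.trans_apply, hx]
  rfl

variable {k : Type w} {V : Type u} [Field k] [Quiver.{v} V] [Fintype V]
  {A : Type t} [Ring A] [Algebra k A] {ν : PathAlgebra k V →ₐ[k] A}

namespace IsAdmissiblePresentation

theorem mem_lengthSpan_two (hν : IsAdmissiblePresentation ν) {x : PathAlgebra k V}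
    (hx : ν x = 0) : x ∈ lengthSpan k V 2 :=
  mem_lengthSpan.2 (hν.2.1 x ((TwoSidedIdeal.mem_ker ν).2 hx))

theorem exists_lengthSpan_le_ker (hν : IsAdmissiblePresentation ν) :
    ∃ m, lengthSpan k V m ≤ LinearMap.ker ν.toLinearMap := by
  obtain ⟨m, hm⟩ := hν.2.2
  refine ⟨m, Submodule.span_le.2 ?_⟩
  rintro _ ⟨p, hp, rfl⟩
  exact (TwoSidedIdeal.mem_ker ν).1 (hm p hp)

theorem map_lengthSpan_one (hν : IsAdmissiblePresentation ν) :
    (lengthSpan k V 1).map ν.toLinearMap = nilSpan k A := by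
  apply le_antisymm
  · rintro _ ⟨x, hx, rfl⟩
    obtain ⟨m, hm⟩ := hν.exists_lengthSpan_le_ker
    refine Submodule.subset_span ⟨m, ?_⟩
    exact (map_pow ν x m).symm.trans (hm (lengthSpan_pow_le m (Submodule.pow_mem_pow _ hx m)))
  · refine Submodule.span_le.2 ?_
    rintro a ⟨n, hn⟩
    obtain ⟨x, rfl⟩ := hν.1 a
    have hx : x ^ n ∈ lengthSpan k V 2 := hν.mem_lengthSpan_two ((map_pow ν x n).trans hn)
    exact ⟨x, mem_lengthSpan_one_of_pow_mem (lengthSpan_antitone one_le_two hx), rfl⟩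

theorem map_lengthSpan_two (hν : IsAdmissiblePresentation ν) :
    (lengthSpan k V 2).map ν.toLinearMap = nilSpan k A * nilSpan k A := by
  rw [← lengthSpan_one_mul_self, Submodule.map_mul, hν.map_lengthSpan_one]

theorem exists_quotient_linearEquiv (hν : IsAdmissiblePresentation ν) {ι : Type*} [Finite ι]
    {j : ι → AnyPath V} (hj : Function.Injective j) {n : ℕ} (hn : n ≤ 2)
    (hrange : Set.range j = {p | p.2.2.length < n}) :
    ∃ e : (A ⧸ (lengthSpan k V n).map ν.toLinearMap) ≃ₗ[k] (ι → k),
      ∀ x, e (Submodule.mkQ _ (ν x)) = pathCoeffs k j x := by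
  have hker : LinearMap.ker (pathCoeffs k j) = lengthSpan k V n := by
    rw [ker_pathCoeffs, hrange, Set.compl_ofPred]
    simp only [not_lt, lengthSpan]
  refine exists_linearEquiv_of_ker_eq
    (f := (Submodule.mkQ ((lengthSpan k V n).map ν.toLinearMap)).comp ν.toLinearMap)
    ((Submodule.mkQ_surjective _).comp hν.1) (pathCoeffs_surjective hj) ?_
  rw [hker, LinearMap.ker_comp, Submodule.ker_mkQ, Submodule.comap_map_eq, sup_eq_left]
  exact fun x hx => lengthSpan_antitone hn (hν.mem_lengthSpan_two hx)

theorem vertexCoeffs_left_eq_right_of_mem_center (hν : IsAdmissiblePresentation ν)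
    {x : PathAlgebra k V} (hx : ν x ∈ Subalgebra.center k A) (α : Total V) :
    vertexCoeffs k V x α.left = vertexCoeffs k V x α.right := by
  have hcomm : PathAlgebra.path k (arrowPath α) * x - x * PathAlgebra.path k (arrowPath α) ∈
      lengthSpan k V 2 := hν.mem_lengthSpan_two <| by
    rw [map_sub, map_mul, map_mul, Subalgebra.mem_center_iff.1 hx, sub_self]
  have hleft : PathAlgebra.path k (arrowPath α) * x -
      vertexCoeffs k V x α.left • PathAlgebra.path k (arrowPath α) ∈ lengthSpan k V 2 :=
    path_mul_sub_mem x (arrowPath α)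
  have hright : x * PathAlgebra.path k (arrowPath α) -
      vertexCoeffs k V x α.right • PathAlgebra.path k (arrowPath α) ∈ lengthSpan k V 2 :=
    mul_path_sub_mem x (arrowPath α)
  have hsmul : (vertexCoeffs k V x α.left - vertexCoeffs k V x α.right) •
      PathAlgebra.path k (arrowPath α) ∈ lengthSpan k V 2 := by
    rw [sub_smul]
    convert sub_mem hcomm (sub_mem hleft hright) using 1
    abel
  by_contra hne
  have hpath := (Submodule.smul_mem_iff _ (sub_ne_zero.2 hne)).1 hsmul
  exact absurd (path_mem_lengthSpan.1 hpath) (by simp [arrowPath])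

theorem vertexCoeffs_eq_of_mem_center (hν : IsAdmissiblePresentation ν) {x : PathAlgebra k V}
    (hx : ν x ∈ Subalgebra.center k A) {a b : V} (u : Walk a b) :
    vertexCoeffs k V x a = vertexCoeffs k V x b := by
  induction u using Walk.induction with
  | nil => rfl
  | arrow _ α ih =>
    exact ih.trans (hν.vertexCoeffs_left_eq_right_of_mem_center hx ⟨_, _, α⟩)
  | invArrow _ α ih =>
    exact ih.trans (hν.vertexCoeffs_left_eq_right_of_mem_center hx ⟨_, _, α⟩).symm

theorem map_vertexSum_mem_center (hν : IsAdmissiblePresentation ν) {f : V → k}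
    (hf : ∀ {a b : V}, Path a b → f a = f b) : ν (vertexSum f) ∈ Subalgebra.center k A := by
  refine Subalgebra.mem_center_iff.2 fun a => ?_
  obtain ⟨x, rfl⟩ := hν.1 a
  suffices x * vertexSum f = vertexSum f * x by rw [← map_mul, ← map_mul, this]
  induction x using PathAlgebra.induction with
  | zero => rw [mul_zero, zero_mul]
  | add x y hx hy => rw [add_mul, mul_add, hx, hy]
  | smul c p =>
    rw [PathAlgebra.smul_mul', PathAlgebra.mul_smul', vertexSum_mul_path, path_mul_vertexSum,
      hf p.2.2]

theorem map_centerImage (hν : IsAdmissiblePresentation ν)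
    {e : (A ⧸ nilSpan k A) ≃ₗ[k] (V → k)}
    (he : ∀ x, e ((nilSpan k A).mkQ (ν x)) = vertexCoeffs k V x) :
    (centerImage k A).map e.toLinearMap =
      LinearMap.range (LinearMap.funLeft k k (WeaklyConnectedComponent.mk (V := V))) := by
  apply le_antisymm
  · rintro _ ⟨_, ⟨a, ha, rfl⟩, rfl⟩
    obtain ⟨x, rfl⟩ := hν.1 a
    refine ⟨fun c => vertexCoeffs k V x (componentBase c),
      Eq.trans (funext fun a => ?_) (he x).symm⟩
    obtain ⟨u⟩ := component_eq_iff.1 (mk_componentBase (WeaklyConnectedComponent.mk a))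
    exact hν.vertexCoeffs_eq_of_mem_center ha u
  · rintro _ ⟨f, rfl⟩
    refine ⟨_, ⟨ν (vertexSum (f ∘ WeaklyConnectedComponent.mk)), ?_, rfl⟩,
      (he _).trans (vertexCoeffs_vertexSum _)⟩
    exact hν.map_vertexSum_mem_center fun p =>
      congrArg f (component_eq_iff.2 ⟨Walk.ofPath p⟩)

theorem finrank_centerImage (hν : IsAdmissiblePresentation ν)
    {e : (A ⧸ nilSpan k A) ≃ₗ[k] (V → k)}
    (he : ∀ x, e ((nilSpan k A).mkQ (ν x)) = vertexCoeffs k V x) :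
    Module.finrank k (centerImage k A) = Nat.card (WeaklyConnectedComponent V) := by
  have := Fintype.ofFinite (WeaklyConnectedComponent V)
  have hinj := LinearMap.funLeft_injective_of_surjective k k _
    fun c => ⟨_, mk_componentBase (V := V) c⟩
  rw [← LinearEquiv.finrank_map_eq e, hν.map_centerImage he, LinearMap.finrank_range_of_inj hinj,
    Module.finrank_fintype_fun_eq_card, Nat.card_eq_fintype_card]

theorem betti_eq [∀ a b : V, Finite (a ⟶ b)] (hν : IsAdmissiblePresentation ν) :
    betti V = algebraBetti k A := by
  have := Fintype.ofFinite (Total V)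
  have hone := hν.exists_quotient_linearEquiv trivialPath_injective one_le_two range_trivialPath
  have htwo := hν.exists_quotient_linearEquiv sumElim_trivialPath_arrowPath_injective le_rfl
    range_sumElim_trivialPath_arrowPath
  rw [hν.map_lengthSpan_one] at hone
  rw [hν.map_lengthSpan_two] at htwo
  obtain ⟨e₁, he₁⟩ := hone
  obtain ⟨e₂, -⟩ := htwo
  rw [betti, algebraBetti, hν.finrank_centerImage he₁, e₁.finrank_eq, e₂.finrank_eq,
    Module.finrank_fintype_fun_eq_card, Module.finrank_fintype_fun_eq_card, Fintype.card_sum,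
    Nat.card_eq_fintype_card, Nat.card_eq_fintype_card]
  push_cast
  ring

end IsAdmissiblePresentation

variable [∀ a b : V, Finite (a ⟶ b)]

theorem IsMonomialPresentation.isGreatest_pi1Dims (hν : IsMonomialPresentation ν) :
    IsGreatest (pi1Dims.{t, w, v, u} k A) (Module.finrank ℤ (cycles V)) := by
  refine ⟨⟨V, ‹_›, ‹_›, ‹_›, ν, hν.1, rank_dualGroup_pi1Prod hν.2⟩, ?_⟩
  rintro d ⟨V', _, _, _, ν', hν', hd⟩
  have hfinrank : (Module.finrank ℤ (cycles V') : ℤ) = Module.finrank ℤ (cycles V) := by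
    rw [finrank_cycles, finrank_cycles, hν'.betti_eq, hν.1.betti_eq]
  have hle := rank_dualGroup_pi1Prod_le (k := k) (TwoSidedIdeal.ker ν')
  rwa [hd, Nat.cast_le, Nat.cast_injective hfinrank] at hle

theorem IsMonomialPresentation.isGreatest_pi1Rank (hν : IsMonomialPresentation ν) :
    IsGreatest (pi1Dims.{t, w, v, u} k A) (pi1Rank.{t, w, v, u} k A) := by
  rw [pi1Rank, hν.isGreatest_pi1Dims.csSup_eq]
  exact hν.isGreatest_pi1Dims

theorem IsMonomialPresentation.pi1Rank_eq_betti (hν : IsMonomialPresentation ν) :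
    (pi1Rank.{t, w, v, u} k A : ℤ) = betti V := by
  rw [pi1Rank, hν.isGreatest_pi1Dims.csSup_eq, finrank_cycles]

end Invariants

section Connectivity

variable {V : Type*} [Quiver V] {W W' : WideSubquiver V}

theorem Joined.nonempty_walk {a b : V} (h : Joined W a b) : Nonempty (Walk a b) :=
  h.map (Walk.map (wideIncl W))

theorem Joined.mono (hW : ∀ a b, W a b ⊆ W' a b) {a b : V} (h : Joined W a b) :
    Joined W' a b :=
  h.map (Walk.map (U := W) (V := W') { obj := fun c => c, map := fun α => ⟨α.1, hW _ _ α.2⟩ })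

end Connectivity

end QuiverAlg

end

theorem mainTheorem8_general {k : Type w} [Field k]
    {A : Type t} [Ring A] [Algebra k A] {B : Type t} [Ring B] [Algebra k B]
    (ι : B →ₙₐ[k] A) (hι : Function.Injective ι)
    {V : Type u} [Fintype V] [Quiver.{v} V] [∀ a b : V, Finite (a ⟶ b)] (QB : Subquiver V)
    (νA : PathAlgebra k V →ₐ[k] A) (hνA : IsMonomialPresentation νA)
    (νB : PathAlgebra k QB.Vert →ₐ[k] B) (hνB : IsMonomialPresentation νB)
    (hν : ∀ x, ι (νB x) = νA (QB.mapAlg x))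
    (T : WideSubquiver V) (hT : QB.IsExtendedMaximalTree T)
    (x₀ : V) (γ : ∀ c : Quiver.WeaklyConnectedComponent QB.Vert, Walk x₀ (componentBase c).1) :
    betti (QB.relQuiver T) = betti V - betti QB.Vert ∧
    (Function.Injective (Subquiver.abMap (Subquiver.compatible_ker hι hν) γ) ∧
      (∃ e : Abelianization (QB.ContractedPi1 (TwoSidedIdeal.ker νA) x₀) ≃*
          Abelianization (Pi1 (TwoSidedIdeal.ker νA) x₀) ⧸
            (Subquiver.abMap (Subquiver.compatible_ker hι hν) γ).range,
        ∀ g : Pi1 (TwoSidedIdeal.ker νA) x₀,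
          e (Abelianization.of (QuotientGroup.mk g)) = QuotientGroup.mk (Abelianization.of g)) ∧
      Nonempty (Abelianization (QB.RelPi1 k T x₀) ≃*
        Abelianization (Pi1 (TwoSidedIdeal.ker νA) x₀) ⧸
          (Subquiver.abMap (Subquiver.compatible_ker hι hν) γ).range)) ∧
    (IsGreatest (pi1Dims.{t, w, v, u} k A) (pi1Rank.{t, w, v, u} k A) ∧
      IsGreatest (pi1Dims.{t, w, v, u} k B) (pi1Rank.{t, w, v, u} k B) ∧
      Module.Finite k (DualGroup k (QB.RelPi1 k T x₀)) ∧
      (Module.finrank k (DualGroup k (QB.RelPi1 k T x₀)) : ℤ) =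
        (pi1Rank.{t, w, v, u} k A : ℤ) - pi1Rank.{t, w, v, u} k B) := by
  have hc := Subquiver.compatible_ker hι hν
  have hx : ∀ y, Nonempty (Walk x₀ y) := fun y => (hT.2.1 x₀ y).nonempty_walk
  have hx' : ∀ y : QB.relQuiver T, Nonempty (Walk (toWide (QB.relQuiver T) x₀) y) := fun y =>
    (hT.2.1 x₀ y).mono fun _ _ => Set.subset_union_right
  have hquot : (QB.contractionSubgroup (TwoSidedIdeal.ker νA) x₀).map Abelianization.of =
      (Subquiver.abMap hc γ).range := Subquiver.map_contractionSubgroup hc γ hνB.2 hνA.2 hx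
  have hrank : Module.rank k (DualGroup k (QB.RelPi1 k T x₀)) =
      Module.finrank ℤ (cycles (QB.relQuiver T)) := rank_dualGroup_pi1 isMonomialIdeal_bot hx'
  have hbetti : betti (QB.relQuiver T) = betti V - betti QB.Vert :=
    Subquiver.betti_relQuiver hT.2.2
  refine ⟨hbetti, ⟨Subquiver.abMap_injective hc γ hνB.2 hνA.2,
    ⟨(abelianizationQuotientEquiv _).trans (QuotientGroup.quotientMulEquivOfEq hquot),
      fun _ => rfl⟩,
    Subquiver.nonempty_abelianization_relPi1_equiv hc γ hνB.2 hνA.2 hT.2.2 hx hx'⟩,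
    hνA.isGreatest_pi1Rank, hνB.isGreatest_pi1Rank, Module.finite_of_rank_eq_nat hrank, ?_⟩
  rw [Module.finrank_eq_of_rank_eq hrank, finrank_cycles, hbetti, hνA.pi1Rank_eq_betti,
    hνB.pi1Rank_eq_betti]

theorem mainTheorem8 {k : Type w} [Field k] [IsAlgClosed k]
    {A : Type t} [Ring A] [Algebra k A] {B : Type t} [Ring B] [Algebra k B]
    -- `B` is a subalgebra of `A` (possibly with a different unit)
    (ι : B →ₙₐ[k] A) (hι : Function.Injective ι)
    -- the quiver of `A`, and the quiver of `B` as a subquiver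
    {V : Type u} [Fintype V] [Quiver.{v} V] [∀ a b : V, Finite (a ⟶ b)] (QB : Subquiver V)
    -- a relative presentation `(νA, νB)` by monomial ideals
    (νA : PathAlgebra k V →ₐ[k] A) (hνA : IsMonomialPresentation νA)
    (νB : PathAlgebra k QB.Vert →ₐ[k] B) (hνB : IsMonomialPresentation νB)
    (hν : ∀ x, ι (νB x) = νA (QB.mapAlg x))
    (hA : IsConnectedAlgebra A)
    -- an extended maximal tree, a base point, and walks to the connected components of `Q_B`
    (T : WideSubquiver V) (hT : QB.IsExtendedMaximalTree T)
    (x₀ : V) (γ : ∀ c : Quiver.WeaklyConnectedComponent QB.Vert, Walk x₀ (componentBase c).1) :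
    betti (QB.relQuiver T) = betti V - betti QB.Vert ∧
    (Function.Injective (Subquiver.abMap (Subquiver.compatible_ker hι hν) γ) ∧
      (∃ e : Abelianization (QB.ContractedPi1 (TwoSidedIdeal.ker νA) x₀) ≃*
          Abelianization (Pi1 (TwoSidedIdeal.ker νA) x₀) ⧸
            (Subquiver.abMap (Subquiver.compatible_ker hι hν) γ).range,
        ∀ g : Pi1 (TwoSidedIdeal.ker νA) x₀,
          e (Abelianization.of (QuotientGroup.mk g)) = QuotientGroup.mk (Abelianization.of g)) ∧
      Nonempty (Abelianization (QB.RelPi1 k T x₀) ≃*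
        Abelianization (Pi1 (TwoSidedIdeal.ker νA) x₀) ⧸
          (Subquiver.abMap (Subquiver.compatible_ker hι hν) γ).range)) ∧
    (IsGreatest (pi1Dims.{t, w, v, u} k A) (pi1Rank.{t, w, v, u} k A) ∧
      IsGreatest (pi1Dims.{t, w, v, u} k B) (pi1Rank.{t, w, v, u} k B) ∧
      Module.Finite k (DualGroup k (QB.RelPi1 k T x₀)) ∧
      (Module.finrank k (DualGroup k (QB.RelPi1 k T x₀)) : ℤ) =
        (pi1Rank.{t, w, v, u} k A : ℤ) - pi1Rank.{t, w, v, u} k B) := by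
  exact mainTheorem8_general ι hι QB νA hνA νB hνB hν T hT x₀ γ
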